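/- Let $D$ be the open unit disc in $\mathbb{R}^2$ and $\overline D$ its closure. For a smooth Riemannian metric $g$ on $\overline D$ consider the eigenvalue problems $\Delta_g u+\gamma u=0$ in $D$ with either the Neumann condition $\partial u/\partial\nu=0$ or the Dirichlet condition $u=0$ on $\partial D$ (with real-valued $u\in C^2(D)\cap C^1(\overline D)$, $u\not\equiv 0$), where $\Delta_g$ is the Laplace--Beltrami operator and $\nu$ the conormal; in each case the eigenvalues are listed in increasing order, $\gamma_1\le\gamma_2\le\cdots$, repeated according to multiplicity. The nodal set of an eigenfunction $u$ is $\overline{\{z\in D: u(z)=0\}}$, and its nodal domains are the connected components of the complement in $D$ of the nodal set. For every positive integer $m$ there are $\delta_0>0$ and a one-parameter family $(g_\delta)_{0<\delta<\delta_0}$ of pairwise distinct smooth Riemannian metrics on $\overline D$, depending smoothly on $\delta$, such that for each $\delta\in(0,\delta_0)$: 1. $g_\delta$ is invariant under rotations of the disc ($S^1$-invariant), has positive Gaussian curvature on $\overline D$, and has total area $\pi$. 2. For the Neumann as well as for the Dirichlet boundary condition, the first $m$ eigenvalues are simple, and for each $1\le j\le m$ every eigenfunction of the $j$-th eigenvalue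 is $S^1$-invariant (radial), its nodal set is the union of $j-1$ disjoint circles centred at the origin, with distinct radii in $(0,1)$, and it has exactly $j$ nodal domains. 3. In the Neumann case there is an eigenfunction $u$ of the second eigenvalue with a strict maximum over $\overline D$ at the origin: $u(z)<u(0)$ for all $z\in\overline D\setminus\{0\}$. In particular, for $m\ge 2$ the simply connected surfaces $(\overline D,g_\delta)$ are counterexamples to the closed nodal line conjecture (the nodal set of a second eigenfunction is a closed curve inside $D$) and to the hot spots conjecture (a second Neumann eigenfunction attains its maximum only at an interior point). -/

import Mathlib

open scoped ContDiff

noncomputable section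

namespace DiscSurface

/-- The open unit disc of the plane, with `z = x + i y` for the point `(x, y)`. -/
abbrev openDisc : Set ℂ := Metric.ball (0 : ℂ) 1

/-- The closed unit disc. -/
abbrev closedDisc : Set ℂ := Metric.closedBall (0 : ℂ) 1

/-- The partial derivative `∂f/∂x` on the closed disc (one-sided at the boundary; at interior
points it is the usual partial derivative). -/
def dX (f : ℂ → ℝ) (z : ℂ) : ℝ := fderivWithin ℝ f closedDisc z 1

/-- The partial derivative `∂f/∂y` on the closed disc. -/
def dY (f : ℂ → ℝ) (z : ℂ) : ℝ := fderivWithin ℝ f closedDisc z Complex.I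

/-- A smooth Riemannian metric `E dx² + 2 F dx dy + G dy²` on the closed unit disc (smooth up to
the boundary). Values outside the closed disc are irrelevant. -/
structure RiemMetric where
  E : ℂ → ℝ
  F : ℂ → ℝ
  G : ℂ → ℝ
  smooth_E : ContDiffOn ℝ ∞ E closedDisc
  smooth_F : ContDiffOn ℝ ∞ F closedDisc
  smooth_G : ContDiffOn ℝ ∞ G closedDisc
  E_pos : ∀ z ∈ closedDisc, 0 < E z
  det_pos : ∀ z ∈ closedDisc, 0 < E z * G z - F z ^ 2

namespace RiemMetric

/-- The inner product of the tangent vectors `ξ`, `η` at the point `z`. -/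
def form (g : RiemMetric) (z ξ η : ℂ) : ℝ :=
  g.E z * (ξ.re * η.re) + g.F z * (ξ.re * η.im + ξ.im * η.re) + g.G z * (ξ.im * η.im)

/-- `g` is invariant under the action of `S¹` by rotations: every rotation is an isometry. -/
def IsRotationInvariant (g : RiemMetric) : Prop :=
  ∀ (w : Circle), ∀ z ∈ closedDisc, ∀ ξ η : ℂ,
    g.form ((w : ℂ) * z) ((w : ℂ) * ξ) ((w : ℂ) * η) = g.form z ξ η

/-- The area density `W = √(EG - F²)`. -/
def W (g : RiemMetric) (z : ℂ) : ℝ := Real.sqrt (g.E z * g.G z - g.F z ^ 2)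

/-- The total area. -/
def area (g : RiemMetric) : ℝ := ∫ z in openDisc, g.W z

/-- The Gaussian curvature, by Brioschi's formula. -/
def curvature (g : RiemMetric) (z : ℂ) : ℝ :=
  (Matrix.det !![-(dY (dY g.E) z) / 2 + dY (dX g.F) z - dX (dX g.G) z / 2,
        dX g.E z / 2, dX g.F z - dY g.E z / 2;
      dY g.F z - dX g.G z / 2, g.E z, g.F z;
      dY g.G z / 2, g.F z, g.G z]
    - Matrix.det !![0, dY g.E z / 2, dX g.G z / 2;
      dY g.E z / 2, g.E z, g.F z;
      dX g.G z / 2, g.F z, g.G z])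
    / (g.E z * g.G z - g.F z ^ 2) ^ 2

/-- First component of `W` times the gradient of `u`. -/
def fluxX (g : RiemMetric) (u : ℂ → ℝ) (z : ℂ) : ℝ := (g.G z * dX u z - g.F z * dY u z) / g.W z

/-- Second component of `W` times the gradient of `u`. -/
def fluxY (g : RiemMetric) (u : ℂ → ℝ) (z : ℂ) : ℝ := (g.E z * dY u z - g.F z * dX u z) / g.W z

/-- The Laplace–Beltrami operator. -/
def laplacian (g : RiemMetric) (u : ℂ → ℝ) (z : ℂ) : ℝ :=
  (dX (g.fluxX u) z + dY (g.fluxY u) z) / g.W z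

/-- The conormal derivative at a point `z` of the unit circle, whose Euclidean outer normal
is `z`. -/
def conormalDeriv (g : RiemMetric) (u : ℂ → ℝ) (z : ℂ) : ℝ :=
  g.fluxX u z * z.re + g.fluxY u z * z.im

end RiemMetric

/-- The two boundary conditions. -/
inductive BoundaryCondition
  | neumann
  | dirichlet

/-- `u` satisfies the boundary condition on the unit circle. -/
def BoundaryCondition.Holds (g : RiemMetric) (u : ℂ → ℝ) : BoundaryCondition → Prop
  | .neumann => ∀ z : ℂ, ‖z‖ = 1 → g.conormalDeriv u z = 0
  | .dirichlet => ∀ z : ℂ, ‖z‖ = 1 → u z = 0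

/-- `u` is an eigenfunction with eigenvalue `γ`: a classical solution, not identically zero on the
disc, of `Δ u + γ u = 0` with the given boundary condition. -/
structure IsEigenfunction (g : RiemMetric) (b : BoundaryCondition) (γ : ℝ) (u : ℂ → ℝ) : Prop where
  contDiff_interior : ContDiffOn ℝ 2 u openDisc
  contDiff_closed : ContDiffOn ℝ 1 u closedDisc
  ne_zero : ∃ z ∈ closedDisc, u z ≠ 0
  equation : ∀ z ∈ openDisc, g.laplacian u z + γ * u z = 0
  boundary : b.Holds g u

/-- The space of functions on the closed disc spanned by the eigenfunctions whose eigenvalue lies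
in the set `S`. -/
def eigenSpan (g : RiemMetric) (b : BoundaryCondition) (S : Set ℝ) :
    Submodule ℝ (closedDisc → ℝ) :=
  Submodule.span ℝ {v | ∃ γ ∈ S, ∃ u, IsEigenfunction g b γ u ∧ v = closedDisc.domRestrict u}

/-- `γ` is the `j`-th eigenvalue (`j = 1, 2, …`) when the eigenvalues are listed in increasing
order, each repeated according to its multiplicity: fewer than `j` of them are `< γ` and at least
`j` of them are `≤ γ`. -/
def IsNthEigenvalue (g : RiemMetric) (b : BoundaryCondition) (j : ℕ) (γ : ℝ) : Prop :=
  Module.rank ℝ (eigenSpan g b (Set.Iio γ)) < (j : Cardinal) ∧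
    (j : Cardinal) ≤ Module.rank ℝ (eigenSpan g b (Set.Iic γ))

/-- The eigenvalue `γ` is simple: its eigenspace is one-dimensional. -/
def IsSimpleEigenvalue (g : RiemMetric) (b : BoundaryCondition) (γ : ℝ) : Prop :=
  Module.rank ℝ (eigenSpan g b {γ}) = 1

/-- `u` is invariant under rotations of the disc. -/
def IsRadial (u : ℂ → ℝ) : Prop :=
  ∀ (w : Circle), ∀ z ∈ closedDisc, u ((w : ℂ) * z) = u z

/-- The nodal set: the closure of the set of zeros in the (open) domain. -/
def nodalSet (u : ℂ → ℝ) : Set ℂ := closure {z ∈ openDisc | u z = 0}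

/-- The nodal domains: the connected components of the complement of the nodal set. -/
abbrev NodalDomains (u : ℂ → ℝ) : Type := ConnectedComponents ↥(openDisc \ nodalSet u)

end DiscSurface

end

/-! The surfaces are long thin caps. With `a = 1/δ`, take in polar coordinates the metric `(1 + a
r²) dr² + r² / (1 + a r²) dθ²`. Its area form is the Euclidean one, so the area is `π`. Its
curvature is `4a / (1 + a r²)³ > 0`. As `a` grows, the meridians get long and the parallels short,
so oscillation around the axis is expensive and oscillation along it is cheap.

Expensive: the Fourier coefficient `c` of order `n ≠ 0` of an eigenfunction and the matching flux
`q` solve `c' = (1 + a r²)/r · q`, `q' = (n² (1 + a r²)/r - γ r) c`. For `γ < 1 + a` both factors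
are positive on `(0, 1)`, because `(1 + a) r² < 1 + a r²` there. Then `c q` is nondecreasing and
vanishes at both ends, which forces `c = 0` (`SolvesSystem.energy`, `circleCoeff_eq_zero`). Hence
every eigenfunction below `1 + a` is radial, and a Wronskian argument makes it a multiple of one
regular solution (`eigenfunction_classification`).

Cheap: put `t = r²`, `γ = 4l`. The radial equation becomes `t s'' + l (1 + a t) s = 0` for the
primitive `s` of the profile `φ`; with `s = t σ` it is solved by an entire power series. The Prüfer
angle of `(φ, K s)` is strictly increasing in `t`, and its final value is continuous and strictly
increasing in `l ≥ 0` (`angle_one_lt`). At `l = K²/a` the final value is at least `K`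
(`le_angle_one`). With `K = M π` this produces `M` radial eigenvalues at most `4K²/a` for either
boundary condition, all below `1 + a` once `a > 2K` (`four_mul_lt`). They are therefore the first
`M` eigenvalues, and they are simple.

The zeros of `φ` are the times at which the angle is an odd multiple of `π/2`. The final angle thus
counts the nodal circles, and the components between them are annuli around a disc. For the second
Neumann eigenvalue the final angle is `π`, so `s > 0` inside; hence `φ' < 0`, and the maximum sits
at the origin only. -/

namespace DiscSurface

/-! ### Entire power series -/

/-- The coefficients are dominated by those of a multiple of an exponential. -/
def ExpBounded (c : ℕ → ℝ) : Prop := ∃ B M : ℝ, ∀ n, |c n| ≤ B * (M ^ n / n.factorial)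

/-- The sum of the power series with the given coefficients. -/
noncomputable def powerSum (c : ℕ → ℝ) (t : ℝ) : ℝ := ∑' n, c n * t ^ n

/-- The coefficients of the derivative of a power series. -/
def derivCoeff (c : ℕ → ℝ) (n : ℕ) : ℝ := (n + 1) * c (n + 1)

theorem ExpBounded.summable_abs {c : ℕ → ℝ} (h : ExpBounded c) (R : ℝ) :
    Summable fun n => |c n| * |R| ^ n := by
  obtain ⟨B, M, hc⟩ := h
  refine Summable.of_nonneg_of_le (fun n => by positivity) (fun n => ?_)
    ((Real.summable_pow_div_factorial (M * |R|)).mul_left B)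
  calc |c n| * |R| ^ n ≤ B * (M ^ n / n.factorial) * |R| ^ n :=
        mul_le_mul_of_nonneg_right (hc n) (by positivity)
    _ = B * ((M * |R|) ^ n / n.factorial) := by rw [mul_pow]; ring

theorem ExpBounded.summable {c : ℕ → ℝ} (h : ExpBounded c) (t : ℝ) :
    Summable fun n => c n * t ^ n := by
  refine Summable.of_norm ?_
  simpa [abs_mul, abs_pow] using h.summable_abs t

theorem ExpBounded.derivCoeff {c : ℕ → ℝ} (h : ExpBounded c) : ExpBounded (derivCoeff c) := by
  obtain ⟨B, M, hc⟩ := h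
  refine ⟨B * M, M, fun n => ?_⟩
  have h1 : |DiscSurface.derivCoeff c n| = (n + 1) * |c (n + 1)| := by
    rw [DiscSurface.derivCoeff, abs_mul, abs_of_nonneg (by positivity)]
  rw [h1]
  calc ((n : ℝ) + 1) * |c (n + 1)| ≤ (n + 1) * (B * (M ^ (n + 1) / (n + 1).factorial)) :=
        mul_le_mul_of_nonneg_left (hc _) (by positivity)
    _ = B * M * (M ^ n / n.factorial) := by
        have : (n.factorial : ℝ) ≠ 0 := by positivity
        rw [Nat.factorial_succ]; push_cast; field_simp; ring

theorem ExpBounded.hasDerivAt {c : ℕ → ℝ} (h : ExpBounded c) (t : ℝ) :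
    HasDerivAt (powerSum c) (powerSum (DiscSurface.derivCoeff c) t) t := by
  -- The differentiated series is dominated on the ball of radius `R` around `0`, which contains
  -- both `t` and the base point `0`.
  set R := |t| + 1
  have hR : 0 ≤ R := by positivity
  have hs : Summable fun n => |c n| * (n * R ^ (n - 1)) := by
    rw [← summable_nat_add_iff 1]
    refine (h.derivCoeff.summable_abs R).congr fun n => ?_
    rw [DiscSurface.derivCoeff, abs_mul, abs_of_nonneg (by positivity : (0 : ℝ) ≤ n + 1),
      abs_of_nonneg hR]
    simp only [Nat.add_sub_cancel]; push_cast; ring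
  have key := hasDerivAt_tsum_of_isPreconnected (g := fun n t => c n * t ^ n)
    (g' := fun n t => c n * (n * t ^ (n - 1))) (t := Metric.ball (0 : ℝ) R) (y₀ := 0) (y := t) hs
    Metric.isOpen_ball (convex_ball _ _).isPreconnected
    (fun n y _ => (hasDerivAt_pow n y).const_mul (c n))
    (fun n y hy => ?_) (by simpa using (by positivity : 0 < R)) (h.summable 0) (by simp [R])
  · have hs' : Summable fun n => c n * (n * t ^ (n - 1)) := by
      rw [← summable_nat_add_iff 1]
      refine (h.derivCoeff.summable t).congr fun n => ?_
      rw [DiscSurface.derivCoeff]; simp only [Nat.add_sub_cancel]; push_cast; ring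
    have e : ∑' n, c n * (n * t ^ (n - 1)) = powerSum (DiscSurface.derivCoeff c) t := by
      rw [hs'.tsum_eq_zero_add, powerSum]
      simp only [Nat.cast_zero, zero_mul, mul_zero, zero_add]
      refine tsum_congr fun n => ?_
      rw [DiscSurface.derivCoeff]; simp only [Nat.add_sub_cancel]; push_cast; ring
    rw [← e]; exact key
  · simp only [Metric.mem_ball, dist_zero_right, Real.norm_eq_abs] at hy
    rw [Real.norm_eq_abs, abs_mul, abs_mul, abs_pow, Nat.abs_cast]
    gcongr

theorem ExpBounded.contDiff {c : ℕ → ℝ} (h : ExpBounded c) : ContDiff ℝ ∞ (powerSum c) := by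
  refine contDiff_infty.2 fun n => ?_
  induction n generalizing c with
  | zero =>
    exact contDiff_zero.2 (continuous_iff_continuousAt.2 fun t => (h.hasDerivAt t).continuousAt)
  | succ n ih =>
    rw [Nat.cast_succ, contDiff_succ_iff_deriv]
    refine ⟨fun t => (h.hasDerivAt t).differentiableAt, by simp, ?_⟩
    rw [show deriv (powerSum c) = powerSum (DiscSurface.derivCoeff c) from
      funext fun t => (h.hasDerivAt t).deriv]
    exact ih h.derivCoeff

theorem powerSum_zero (c : ℕ → ℝ) : powerSum c 0 = c 0 := by
  rw [powerSum, tsum_eq_single 0 (fun n hn => by simp [hn])]; simp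

/-- A bound uniform for `l` in bounded sets makes the series converge locally uniformly in both
variables. Joint continuity is what later lets the Prüfer angle depend continuously on the spectral
parameter. -/
theorem continuous_powerSum_family {c : ℝ → ℕ → ℝ} (hc : ∀ n, Continuous fun l => c l n)
    (hb : ∀ R, ∃ M : ℝ, ∀ l, |l| ≤ R → ∀ n, |c l n| ≤ M ^ n / n.factorial) :
    Continuous fun q : ℝ × ℝ => powerSum (c q.1) q.2 := by
  refine continuous_iff_continuousAt.2 fun q => ?_
  set R := ‖q‖ + 1
  obtain ⟨M, hM⟩ := hb R
  have hcont : ContinuousOn (fun q : ℝ × ℝ => powerSum (c q.1) q.2) (Metric.ball 0 R) := by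
    simp only [powerSum]
    refine continuousOn_tsum (f := fun n (q : ℝ × ℝ) => c q.1 n * q.2 ^ n)
      (u := fun n => (M * R) ^ n / n.factorial) (fun n => ?_)
      (Real.summable_pow_div_factorial _) (fun n x hx => ?_)
    · exact (((hc n).comp continuous_fst).mul (continuous_snd.pow n)).continuousOn
    · rw [Metric.mem_ball, dist_zero_right, Prod.norm_def, max_lt_iff] at hx
      simp only [Real.norm_eq_abs] at hx ⊢
      rw [abs_mul, abs_pow, mul_pow, mul_div_right_comm]
      have h1 := hM x.1 hx.1.le n
      have h2 : |x.2| ^ n ≤ R ^ n := pow_le_pow_left₀ (abs_nonneg _) hx.2.le n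
      exact mul_le_mul h1 h2 (by positivity) ((abs_nonneg _).trans h1)
  exact hcont.continuousAt (Metric.isOpen_ball.mem_nhds (by simp [R]))

/-! ### The regular solution of the radial equation -/

/-- The coefficients of the solution `σ` of `t σ'' + 2 σ' + l (1 + a t) σ = 0`, `σ 0 = 1`. -/
noncomputable def solCoeff (a l : ℝ) : ℕ → ℝ
  | 0 => 1
  | 1 => -l / 2
  | n + 2 => -l * (solCoeff a l (n + 1) + a * solCoeff a l n) / ((n + 2) * (n + 3))

theorem continuous_solCoeff (a : ℝ) (n : ℕ) : Continuous fun l => solCoeff a l n := by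
  induction n using Nat.twoStepInduction with
  | zero => simpa [solCoeff] using continuous_const
  | one => simp only [solCoeff]; fun_prop
  | more n h1 h2 =>
    simp only [solCoeff]
    exact ((continuous_neg.mul (h2.add (continuous_const.mul h1)))).div_const _

theorem abs_solCoeff_le {a l M : ℝ} (hl : |l| ≤ M) (ha : |a| ≤ M) (n : ℕ) :
    |solCoeff a l n| ≤ M ^ n / n.factorial := by
  have hM : 0 ≤ M := (abs_nonneg _).trans hl
  induction n using Nat.twoStepInduction with
  | zero => simp [solCoeff]
  | one =>
    simp only [solCoeff, pow_one, Nat.factorial_one, Nat.cast_one, div_one]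
    rw [abs_div, abs_neg, abs_two]
    linarith [abs_nonneg l]
  | more n h1 h2 =>
    have hn : (0 : ℝ) < n.factorial := by positivity
    simp only [solCoeff]
    rw [abs_div, abs_mul, abs_neg, abs_of_pos (by positivity : (0 : ℝ) < (n + 2) * (n + 3)),
      div_le_iff₀ (by positivity)]
    have h3 : |solCoeff a l (n + 1) + a * solCoeff a l n| ≤
        M ^ (n + 1) / (n + 1).factorial + M * (M ^ n / n.factorial) := by
      refine (abs_add_le _ _).trans (add_le_add h2 ?_)
      rw [abs_mul]
      exact mul_le_mul ha h1 (abs_nonneg _) hM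
    -- The two terms add up to `M ^ (n + 2) / (n + 2)!` times `(n + 2)²`, and the denominator `(n +
    -- 2)(n + 3)` of the recursion absorbs this square.
    calc |l| * |solCoeff a l (n + 1) + a * solCoeff a l n|
        ≤ M * (M ^ (n + 1) / (n + 1).factorial + M * (M ^ n / n.factorial)) :=
          mul_le_mul hl h3 (abs_nonneg _) hM
      _ = M ^ (n + 2) / (n + 2).factorial * ((n + 2) * (n + 2)) := by
          rw [Nat.factorial_succ (n + 1), Nat.factorial_succ n]; push_cast
          field_simp; ring
      _ ≤ _ := by gcongr; norm_num

theorem expBounded_solCoeff (a l : ℝ) : ExpBounded (solCoeff a l) :=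
  ⟨1, max |l| |a|, fun n => by
    simpa using abs_solCoeff_le (le_max_left |l| |a|) (le_max_right |l| |a|) n⟩

/-- The function `σ`; the primitive `s` of the regular radial solution is `t σ(t)`. -/
noncomputable def sol (a l t : ℝ) : ℝ := powerSum (solCoeff a l) t

/-- The regular radial solution `φ = (t σ)'`. -/
noncomputable def radialSol (a l t : ℝ) : ℝ := powerSum (fun n => (n + 1) * solCoeff a l n) t

/-- The primitive `s = t σ` of the regular radial solution. -/
noncomputable def primSol (a l t : ℝ) : ℝ := t * sol a l t

theorem abs_radialCoeff_le {a l M : ℝ} (hl : |l| ≤ M) (ha : |a| ≤ M) (n : ℕ) :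
    |((n : ℝ) + 1) * solCoeff a l n| ≤ (2 * M) ^ n / n.factorial := by
  rw [abs_mul, abs_of_nonneg (by positivity : (0 : ℝ) ≤ n + 1), mul_pow, mul_div_assoc]
  refine mul_le_mul ?_ (abs_solCoeff_le hl ha n) (abs_nonneg _) (by positivity)
  exact_mod_cast Nat.lt_two_pow_self

theorem expBounded_radialCoeff (a l : ℝ) : ExpBounded fun n => (n + 1) * solCoeff a l n :=
  ⟨1, 2 * max |l| |a|, fun n => by
    simpa using abs_radialCoeff_le (le_max_left |l| |a|) (le_max_right |l| |a|) n⟩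

theorem continuous_sol (a : ℝ) : Continuous fun q : ℝ × ℝ => sol a q.1 q.2 :=
  continuous_powerSum_family (continuous_solCoeff a) fun R => ⟨max R |a|, fun _ hl n =>
    abs_solCoeff_le (hl.trans (le_max_left _ _)) (le_max_right _ _) n⟩

theorem continuous_radialSol (a : ℝ) : Continuous fun q : ℝ × ℝ => radialSol a q.1 q.2 :=
  continuous_powerSum_family (fun n => continuous_const.mul (continuous_solCoeff a n)) fun R =>
    ⟨2 * max R |a|, fun _ hl n =>
      abs_radialCoeff_le (hl.trans (le_max_left _ _)) (le_max_right _ _) n⟩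

theorem contDiff_sol (a l : ℝ) : ContDiff ℝ ∞ (sol a l) := (expBounded_solCoeff a l).contDiff

theorem contDiff_radialSol (a l : ℝ) : ContDiff ℝ ∞ (radialSol a l) :=
  (expBounded_radialCoeff a l).contDiff

theorem radialSol_zero (a l : ℝ) : radialSol a l 0 = 1 := by
  simp [radialSol, powerSum_zero, solCoeff]

theorem primSol_zero (a l : ℝ) : primSol a l 0 = 0 := by simp [primSol]

theorem hasDerivAt_primSol (a l t : ℝ) : HasDerivAt (primSol a l) (radialSol a l t) t := by
  have hb := expBounded_solCoeff a l
  have h := (hasDerivAt_id t).mul (hb.hasDerivAt t)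
  refine h.congr_deriv ?_
  have e : powerSum (derivCoeff (solCoeff a l)) t * t =
      ∑' n : ℕ, (n : ℝ) * solCoeff a l n * t ^ n := by
    have hs : Summable fun n : ℕ => (n : ℝ) * solCoeff a l n * t ^ n := by
      have := ((expBounded_radialCoeff a l).summable t).sub (hb.summable t)
      refine this.congr fun n => ?_
      ring
    rw [hs.tsum_eq_zero_add, powerSum, ← tsum_mul_right]
    simp only [Nat.cast_zero, zero_mul, zero_add]
    refine tsum_congr fun n => ?_
    rw [derivCoeff]; push_cast; ring
  have hs2 : Summable fun n : ℕ => (n : ℝ) * solCoeff a l n * t ^ n := by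
    have := ((expBounded_radialCoeff a l).summable t).sub (hb.summable t)
    refine this.congr fun n => ?_
    ring
  simp only [id, one_mul]
  rw [mul_comm t, e, powerSum, radialSol, powerSum, ← (hb.summable t).tsum_add hs2]
  exact tsum_congr fun n => by ring

/-- The recursion for the coefficients is exactly this equation. Written with `σ = s / t`, it has no
singularity at `t = 0`. -/
theorem hasDerivAt_radialSol (a l t : ℝ) :
    HasDerivAt (radialSol a l) (-l * (1 + a * t) * sol a l t) t := by
  have hb := expBounded_solCoeff a l
  refine ((expBounded_radialCoeff a l).hasDerivAt t).congr_deriv ?_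
  have hs1 := ((expBounded_radialCoeff a l).derivCoeff.summable t)
  have hs2 : Summable fun n => -l * (solCoeff a l (n + 1) * t ^ (n + 1)) :=
    ((summable_nat_add_iff 1).2 (hb.summable t)).mul_left _
  have hs3 : Summable fun n => -l * (a * t * (solCoeff a l n * t ^ n)) :=
    ((hb.summable t).mul_left _).mul_left _
  rw [powerSum, hs1.tsum_eq_zero_add]
  have e : ∀ n : ℕ, derivCoeff (fun n => (n + 1) * solCoeff a l n) (n + 1) * t ^ (n + 1) =
      -l * (solCoeff a l (n + 1) * t ^ (n + 1)) + -l * (a * t * (solCoeff a l n * t ^ n)) := by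
    intro n
    simp only [derivCoeff, solCoeff]; push_cast
    have : (n : ℝ) + 2 ≠ 0 := by positivity
    have : (n : ℝ) + 3 ≠ 0 := by positivity
    field_simp; ring
  rw [tsum_congr e, hs2.tsum_add hs3, tsum_mul_left, tsum_mul_left, tsum_mul_left, sol, powerSum,
    (hb.summable t).tsum_eq_zero_add]
  simp [derivCoeff, solCoeff]; ring

theorem continuous_primSol (a : ℝ) : Continuous fun q : ℝ × ℝ => primSol a q.1 q.2 :=
  continuous_snd.mul (continuous_sol a)

/-! ### The Prüfer angle -/

/-- Grönwall's inequality by integrating factor: `f t * exp (M t)` has nonnegative derivative. -/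
theorem mul_exp_le_of_deriv_ge {f f' : ℝ → ℝ} {x y M : ℝ} (hxy : x ≤ y)
    (hc : ContinuousOn f (Set.Icc x y)) (hd : ∀ t ∈ Set.Ioo x y, HasDerivAt f (f' t) t)
    (hf : ∀ t ∈ Set.Ioo x y, -M * f t ≤ f' t) :
    f x * Real.exp (M * x) ≤ f y * Real.exp (M * y) := by
  have hmono : MonotoneOn (fun t => f t * Real.exp (M * t)) (Set.Icc x y) := by
    have hder : ∀ t ∈ Set.Ioo x y, HasDerivAt (fun t => f t * Real.exp (M * t))
        (f' t * Real.exp (M * t) + f t * (Real.exp (M * t) * M)) t := fun t ht =>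
      (hd t ht).mul (by simpa using ((hasDerivAt_id t).const_mul M).exp)
    refine monotoneOn_of_deriv_nonneg (convex_Icc _ _) (hc.mul (by fun_prop)) ?_ ?_
    · rw [interior_Icc]
      exact fun t ht => (hder t ht).differentiableAt.differentiableWithinAt
    · rw [interior_Icc]
      intro t ht
      rw [(hder t ht).deriv]
      nlinarith [mul_nonneg (sub_nonneg.2 (hf t ht)) (Real.exp_pos (M * t)).le]
  exact hmono (Set.left_mem_Icc.2 hxy) (Set.right_mem_Icc.2 hxy) hxy

theorem hasDerivAt_radialSol_of_pos (a l : ℝ) {t : ℝ} (ht : t ≠ 0) :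
    HasDerivAt (radialSol a l) (-l * ((1 + a * t) / t) * primSol a l t) t := by
  refine (hasDerivAt_radialSol a l t).congr_deriv ?_
  rw [primSol]; field_simp

theorem continuous_radialSol_right (a l : ℝ) : Continuous (radialSol a l) :=
  (contDiff_radialSol a l).continuous

theorem continuous_sol_right (a l : ℝ) : Continuous (sol a l) :=
  (contDiff_sol a l).continuous

theorem continuous_primSol_right (a l : ℝ) : Continuous (primSol a l) :=
  continuous_id.mul (continuous_sol_right a l)

/-- The regular solution and its primitive have no common zero. -/
theorem radialSol_ne_zero_or (a l : ℝ) {t : ℝ} (ht : 0 ≤ t) :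
    radialSol a l t ≠ 0 ∨ primSol a l t ≠ 0 := by
  rcases ht.eq_or_lt with rfl | ht
  · simp [radialSol_zero]
  by_contra! h
  obtain ⟨h1, h2⟩ := h
  -- The first order system is singular at `0`, so the uniqueness argument starts from a point `x >
  -- 0` where `φ` is still nonzero.
  have hev : ∀ᶠ x in nhdsWithin (0 : ℝ) (Set.Ioi 0), radialSol a l x ≠ 0 ∧ x < t := by
    refine Filter.Eventually.and ?_ ?_
    · exact ((continuous_radialSol_right a l).continuousAt.eventually_ne
        (by simp [radialSol_zero])).filter_mono nhdsWithin_le_nhds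
    · exact (eventually_lt_nhds ht).filter_mono nhdsWithin_le_nhds
  obtain ⟨x, ⟨hx, hxt⟩, hx0⟩ := (hev.and self_mem_nhdsWithin).exists
  -- On `[x, t]` the coefficient `1 - l (1 + a τ) / τ` is bounded by `M`, and `(φ² + s²)'` is this
  -- coefficient times `2 φ s`. So `φ² + s²` decays at most exponentially and cannot reach zero.
  set M := |l| * ((1 + |a| * t) / x) + 1 with hM
  have key := mul_exp_le_of_deriv_ge (f := fun t => radialSol a l t ^ 2 + primSol a l t ^ 2)
    (f' := fun t => 2 * radialSol a l t * (-l * ((1 + a * t) / t) * primSol a l t) +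
      2 * primSol a l t * radialSol a l t) (M := M) hxt.le
    (((continuous_radialSol_right a l).pow 2).add
      ((continuous_primSol_right a l).pow 2)).continuousOn
    (fun τ hτ => by
      have h1 := (hasDerivAt_radialSol_of_pos a l (hx0.trans hτ.1).ne').pow 2
      have h2 := (hasDerivAt_primSol a l τ).pow 2
      refine (h1.add h2).congr_deriv ?_
      simp) (fun τ hτ => ?_)
  · simp only [h1, h2] at key
    have : 0 < radialSol a l x ^ 2 + primSol a l x ^ 2 := by positivity
    have := mul_pos this (Real.exp_pos (M * x))
    norm_num at key
    linarith
  · set p := radialSol a l τ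
    set s := primSol a l τ
    have hτ0 : 0 < τ := hx0.trans hτ.1
    have hb : |l * ((1 + a * τ) / τ)| ≤ |l| * ((1 + |a| * t) / x) := by
      rw [abs_mul, abs_div, abs_of_pos hτ0]
      gcongr
      · refine (abs_add_le _ _).trans ?_
        rw [abs_one, abs_mul, abs_of_pos hτ0]
        gcongr
        exact hτ.2.le
      · exact hτ.1.le
    have h3 : |2 * p * s| ≤ p ^ 2 + s ^ 2 := by
      rw [abs_le]; constructor <;> nlinarith [sq_nonneg (p + s), sq_nonneg (p - s)]
    have h4 : |1 - l * ((1 + a * τ) / τ)| ≤ M := by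
      refine (abs_sub _ _).trans ?_
      rw [abs_one, hM]; linarith
    have h5 : |(1 - l * ((1 + a * τ) / τ)) * (2 * p * s)| ≤ M * (p ^ 2 + s ^ 2) := by
      rw [abs_mul]
      exact mul_le_mul h4 h3 (abs_nonneg _) ((abs_nonneg _).trans h4)
    have := (abs_le.1 h5).1
    linarith

/-- The squared Prüfer radius at scale `K`. -/
noncomputable def radiusSq (a K l t : ℝ) : ℝ := radialSol a l t ^ 2 + (K * primSol a l t) ^ 2

theorem radiusSq_pos (a l : ℝ) {K t : ℝ} (hK : 0 < K) (ht : 0 ≤ t) : 0 < radiusSq a K l t := by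
  unfold radiusSq
  rcases radialSol_ne_zero_or a l ht with h | h <;> positivity

/-- The derivative of the Prüfer angle (continued constantly to negative times). -/
noncomputable def angleRate (a K l t : ℝ) : ℝ :=
  K * (radialSol a l (max t 0) ^ 2 +
    l * (1 + a * max t 0) * sol a l (max t 0) * primSol a l (max t 0)) /
      radiusSq a K l (max t 0)

/-- The Prüfer angle at scale `K` of the regular radial solution. -/
noncomputable def angle (a K l t : ℝ) : ℝ := ∫ τ in (0 : ℝ)..t, angleRate a K l τ

section

variable {a K : ℝ}

theorem continuous_angleRate (hK : 0 < K) :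
    Continuous fun q : ℝ × ℝ => angleRate a K q.1 q.2 := by
  have hm : Continuous fun q : ℝ × ℝ => (q.1, max q.2 0) := by fun_prop
  have h1 := (continuous_radialSol a).comp hm
  have h2 := (continuous_sol a).comp hm
  have h3 := (continuous_primSol a).comp hm
  simp only [Function.comp_def] at h1 h2 h3
  unfold angleRate
  refine Continuous.div ?_ ?_ fun q => (radiusSq_pos a q.1 hK (le_max_right _ _)).ne'
  · fun_prop
  · unfold radiusSq; fun_prop

theorem continuous_angleRate_right (hK : 0 < K) (l : ℝ) : Continuous (angleRate a K l) :=
  (continuous_angleRate hK).comp (Continuous.prodMk_right l)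

theorem hasDerivAt_angle (hK : 0 < K) (l t : ℝ) :
    HasDerivAt (angle a K l) (angleRate a K l t) t :=
  intervalIntegral.integral_hasDerivAt_right
    ((continuous_angleRate_right hK l).intervalIntegrable _ _)
    (continuous_angleRate_right hK l).stronglyMeasurable.stronglyMeasurableAtFilter
    (continuous_angleRate_right hK l).continuousAt

theorem continuous_angle_right (hK : 0 < K) (l : ℝ) : Continuous (angle a K l) :=
  continuous_iff_continuousAt.2 fun t => (hasDerivAt_angle hK l t).continuousAt

theorem continuous_angle_left (hK : 0 < K) (t : ℝ) : Continuous fun l => angle a K l t :=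
  intervalIntegral.continuous_parametric_intervalIntegral_of_continuous'
    (continuous_angleRate hK) _ _

theorem angle_zero (l : ℝ) : angle a K l 0 = 0 := by simp [angle]

theorem angleRate_eq (l : ℝ) {t : ℝ} (ht : 0 ≤ t) :
    angleRate a K l t = K * (radialSol a l t ^ 2 + l * (1 + a * t) * sol a l t * primSol a l t) /
      radiusSq a K l t := by
  rw [angleRate, max_eq_left ht]

/-- The polar representation of the regular solution and its primitive. -/
theorem polar (hK : 0 < K) (l : ℝ) {t : ℝ} (ht : 0 ≤ t) :
    radialSol a l t = √(radiusSq a K l t) * Real.cos (angle a K l t) ∧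
      K * primSol a l t = √(radiusSq a K l t) * Real.sin (angle a K l t) := by
  set R := fun t => √(radiusSq a K l t) with hR
  have hRpos : ∀ x, 0 ≤ x → 0 < R x := fun x hx => Real.sqrt_pos.2 (radiusSq_pos a l hK hx)
  have hRsq : ∀ x, 0 ≤ x → R x ^ 2 = radialSol a l x ^ 2 + (K * primSol a l x) ^ 2 := fun x hx =>
    Real.sq_sqrt (radiusSq_pos a l hK hx).le
  -- Inner product of the unit vectors `(φ, K s) / R` and `(cos, sin)` of the angle. It is constant
  -- and starts at `1`, so the two vectors coincide throughout.
  set f := fun x => radialSol a l x / R x * Real.cos (angle a K l x) +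
    K * primSol a l x / R x * Real.sin (angle a K l x) with hf
  have hder : ∀ x, 0 ≤ x → HasDerivAt f 0 x := by
    intro x hx
    have h1 := hasDerivAt_radialSol a l x
    have h2 := (hasDerivAt_primSol a l x).const_mul K
    have hpos := hRpos x hx
    have hsq := hRsq x hx
    have h3 : HasDerivAt R ((radialSol a l x * (-l * (1 + a * x) * sol a l x) +
        K * primSol a l x * (K * radialSol a l x)) / R x) x := by
      refine (((h1.pow 2).add (h2.pow 2)).sqrt (radiusSq_pos a l hK hx).ne').congr_deriv ?_
      have e : √(((radialSol a l) ^ 2 + (fun y => K * primSol a l y) ^ 2) x) = R x := rfl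
      rw [e]
      norm_num
      field_simp
    have h4 := hasDerivAt_angle (a := a) hK l x
    refine (((h1.div h3 hpos.ne').mul h4.cos).add
      ((h2.div h3 hpos.ne').mul h4.sin)).congr_deriv ?_
    rw [angleRate_eq l hx, radiusSq, ← hsq]
    clear h3 h4 hf hR
    simp only [Pi.div_apply]
    generalize Real.cos (angle a K l x) = c
    generalize Real.sin (angle a K l x) = d
    generalize R x = r at *
    generalize radialSol a l x = p at *
    generalize primSol a l x = s at *
    generalize sol a l x = g at *
    field_simp
    linear_combination (-(l * g * (1 + a * x) * c) + p * K * d) * hsq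
  have hconst : f t = f 0 :=
    constant_of_has_deriv_right_zero (a := 0) (b := t)
      (fun x hx => (hder x hx.1).continuousAt.continuousWithinAt)
      (fun x hx => (hder x hx.1).hasDerivWithinAt) t ⟨ht, le_rfl⟩
  have hf0 : f 0 = 1 := by
    simp [hf, hR, angle_zero, radialSol_zero, primSol_zero, radiusSq]
  rw [hf0] at hconst
  simp only [hf] at hconst
  have hpos := hRpos t ht
  have hsq := hRsq t ht
  have hcs := Real.sin_sq_add_cos_sq (angle a K l t)
  change radialSol a l t = R t * _ ∧ K * primSol a l t = R t * _
  have hsum : (radialSol a l t / R t - Real.cos (angle a K l t)) ^ 2 +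
      (K * primSol a l t / R t - Real.sin (angle a K l t)) ^ 2 = 0 := by
    have : (radialSol a l t / R t) ^ 2 + (K * primSol a l t / R t) ^ 2 = 1 := by
      rw [div_pow, div_pow, ← add_div, ← hsq, div_self (by positivity)]
    nlinarith
  have e1 : radialSol a l t / R t - Real.cos (angle a K l t) = 0 := by
    nlinarith [sq_nonneg (radialSol a l t / R t - Real.cos (angle a K l t)),
      sq_nonneg (K * primSol a l t / R t - Real.sin (angle a K l t))]
  have e2 : K * primSol a l t / R t - Real.sin (angle a K l t) = 0 := by
    nlinarith [sq_nonneg (radialSol a l t / R t - Real.cos (angle a K l t)),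
      sq_nonneg (K * primSol a l t / R t - Real.sin (angle a K l t))]
  constructor
  · rw [← sub_eq_zero.1 e1]; field_simp
  · rw [← sub_eq_zero.1 e2]; field_simp

theorem radialSol_eq_zero_iff (hK : 0 < K) (l : ℝ) {t : ℝ} (ht : 0 ≤ t) :
    radialSol a l t = 0 ↔ Real.cos (angle a K l t) = 0 := by
  rw [(polar hK l ht).1, mul_eq_zero, or_iff_right (Real.sqrt_pos.2 (radiusSq_pos a l hK ht)).ne']

theorem primSol_eq_zero_iff (hK : 0 < K) (l : ℝ) {t : ℝ} (ht : 0 ≤ t) :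
    primSol a l t = 0 ↔ Real.sin (angle a K l t) = 0 := by
  rw [← mul_right_inj' hK.ne', mul_zero, (polar hK l ht).2, mul_eq_zero,
    or_iff_right (Real.sqrt_pos.2 (radiusSq_pos a l hK ht)).ne']

theorem radialSol_param_zero (t : ℝ) : radialSol a 0 t = 1 := by
  have h := is_const_of_deriv_eq_zero
    (fun t => (hasDerivAt_radialSol a 0 t).differentiableAt)
    (fun t => by rw [(hasDerivAt_radialSol a 0 t).deriv]; simp) t 0
  rw [h, radialSol_zero]

theorem angleRate_pos (ha : 0 ≤ a) (hK : 0 < K) {l t : ℝ} (hl : 0 ≤ l) (ht : 0 ≤ t) :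
    0 < angleRate a K l t := by
  rw [angleRate_eq l ht]
  refine div_pos (mul_pos hK ?_) (radiusSq_pos a l hK ht)
  have e : l * (1 + a * t) * sol a l t * primSol a l t = l * (1 + a * t) * t * sol a l t ^ 2 := by
    rw [primSol]; ring
  rw [e]
  by_cases h : radialSol a l t = 0
  · have hs := (radialSol_ne_zero_or a l ht).resolve_left (not_not.2 h)
    have ht' : t ≠ 0 := fun h0 => hs (by simp [h0, primSol_zero])
    have hs' : sol a l t ≠ 0 := fun h0 => hs (by simp [primSol, h0])
    have hl' : l ≠ 0 := by
      rintro rfl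
      simp [radialSol_param_zero] at h
    have : 0 < l := lt_of_le_of_ne hl hl'.symm
    have : 0 < t := lt_of_le_of_ne ht ht'.symm
    positivity
  · positivity

theorem strictMonoOn_angle (ha : 0 ≤ a) (hK : 0 < K) {l : ℝ} (hl : 0 ≤ l) :
    StrictMonoOn (angle a K l) (Set.Ici 0) := by
  refine strictMonoOn_of_deriv_pos (convex_Ici 0) (continuous_angle_right hK l).continuousOn ?_
  rw [interior_Ici]
  intro t ht
  rw [(hasDerivAt_angle hK l t).deriv]
  exact angleRate_pos ha hK hl (le_of_lt ht)

/-- For `l = 0` the solution is constantly `1`; reaching `π / 2` would give it a zero. -/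
theorem angle_param_zero_lt (hK : 0 < K) : angle a K 0 1 < Real.pi / 2 := by
  by_contra! h
  obtain ⟨t, ht, hte⟩ := intermediate_value_Icc (zero_le_one (α := ℝ))
    (continuous_angle_right (a := a) hK 0).continuousOn
    (show Real.pi / 2 ∈ Set.Icc (angle a K 0 0) (angle a K 0 1) from
      ⟨by rw [angle_zero]; positivity, h⟩)
  have := (radialSol_eq_zero_iff (a := a) hK 0 ht.1).2 (by rw [hte, Real.cos_pi_div_two])
  simp [radialSol_param_zero] at this

/-- The choice `l a = K²` makes the `a`-part of the numerator of the rate equal to `(K s)²`; the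
rest is nonnegative, so the rate is at least `K`. This is why the radial eigenvalues are of order `1
/ a`. -/
theorem le_angle_one (ha : 0 < a) (hK : 0 < K) : K ≤ angle a K (K ^ 2 / a) 1 := by
  set l := K ^ 2 / a with hl
  have hl0 : 0 < l := by positivity
  have hla : l * a = K ^ 2 := by rw [hl]; field_simp
  have h : ∀ t ∈ Set.Icc (0 : ℝ) 1, K ≤ angleRate a K l t := by
    intro t ht
    rw [angleRate_eq l ht.1, le_div_iff₀ (radiusSq_pos a l hK ht.1), radiusSq, primSol]
    gcongr
    have h0 : 0 ≤ l * t * sol a l t ^ 2 := mul_nonneg (mul_nonneg hl0.le ht.1) (sq_nonneg _)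
    have e : l * (1 + a * t) * sol a l t * (t * sol a l t) =
      l * t * sol a l t ^ 2 + (l * a) * (t * sol a l t) ^ 2 := by ring
    rw [e, hla]
    nlinarith
  calc K = ∫ _ in (0 : ℝ)..1, K := by simp
    _ ≤ angle a K l 1 := intervalIntegral.integral_mono_on zero_le_one (by simp)
        ((continuous_angleRate_right hK l).intervalIntegrable _ _) h

theorem angleRate_eq_trig (hK : 0 < K) (l : ℝ) {t : ℝ} (ht : 0 < t) :
    angleRate a K l t = K * Real.cos (angle a K l t) ^ 2 +
      l * ((1 + a * t) / t) / K * Real.sin (angle a K l t) ^ 2 := by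
  obtain ⟨h1, h2⟩ := polar (a := a) hK l ht.le
  have hpos := radiusSq_pos a l hK ht.le
  have hsq := Real.sq_sqrt hpos.le
  have hne := (Real.sqrt_pos.2 hpos).ne'
  have e : sol a l t * primSol a l t = (K * primSol a l t) ^ 2 / (K ^ 2 * t) := by
    rw [primSol]; field_simp
  rw [angleRate_eq l ht.le, mul_assoc (l * _), e, h1, h2]
  generalize √(radiusSq a K l t) = r at *
  rw [← hsq]
  field_simp

/-- The linear bound at `0` compensates the factor `1 / t` in the Prüfer equation. -/
theorem angle_le_mul (hK : 0 < K) (l : ℝ) :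
    ∃ C, 0 ≤ C ∧ ∀ t ∈ Set.Icc (0 : ℝ) 1, |angle a K l t| ≤ C * t := by
  obtain ⟨C, hC⟩ := isCompact_Icc.exists_bound_of_continuousOn
    (continuous_angleRate_right (a := a) hK l).continuousOn (s := Set.Icc (0 : ℝ) 1)
  refine ⟨C, (norm_nonneg _).trans (hC 0 (by simp)), fun t ht => ?_⟩
  have := intervalIntegral.norm_integral_le_of_norm_le_const (a := 0) (b := t)
    (f := angleRate a K l) (C := C) fun x hx => by
      rw [Set.uIoc_of_le ht.1] at hx
      exact hC x ⟨hx.1.le, hx.2.trans ht.2⟩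
  simpa [angle, abs_of_nonneg ht.1] using this

/-- A continuous function starting at zero cannot become negative if its derivative is at least
`-M` times its absolute value. -/
theorem nonneg_of_deriv_ge {f f' : ℝ → ℝ} {M : ℝ} (hc : Continuous f) (h0 : f 0 = 0)
    (hd : ∀ t ∈ Set.Ioo (0 : ℝ) 1, HasDerivAt f (f' t) t)
    (hf : ∀ t ∈ Set.Ioo (0 : ℝ) 1, -M * |f t| ≤ f' t) {t : ℝ} (ht : t ∈ Set.Icc (0 : ℝ) 1) :
    0 ≤ f t := by
  by_contra! hneg
  set Z := Set.Icc 0 t ∩ f ⁻¹' Set.Ici 0 with hZ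
  have hZc : IsCompact Z := isCompact_Icc.inter_right (isClosed_Ici.preimage hc)
  have hZn : Z.Nonempty := ⟨0, ⟨le_rfl, ht.1⟩, by simp [h0]⟩
  obtain ⟨x, hx, hmax⟩ := hZc.exists_isGreatest hZn
  have hxt : x < t := lt_of_le_of_ne hx.1.2 fun h => by
    have := hx.2
    rw [h] at this
    exact not_le.2 hneg this
  have hlt : ∀ y ∈ Set.Ioo x t, f y < 0 := fun y hy => by
    by_contra! h
    exact not_le.2 hy.1 (hmax ⟨⟨hx.1.1.trans hy.1.le, hy.2.le⟩, h⟩)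
  -- After the last point `x` with `f x ≥ 0` the function is negative, so `-M * |f| = M * f` and
  -- Grönwall applies with the opposite sign.
  have key := mul_exp_le_of_deriv_ge (f := f) (f' := f') (M := -M) hxt.le hc.continuousOn
    (fun y hy => hd y ⟨hx.1.1.trans_lt hy.1, hy.2.trans_le ht.2⟩) fun y hy => by
      have := hf y ⟨hx.1.1.trans_lt hy.1, hy.2.trans_le ht.2⟩
      rw [abs_of_neg (hlt y hy)] at this
      linarith
  have h1 : 0 ≤ f x * Real.exp (-M * x) := mul_nonneg hx.2 (Real.exp_pos _).le
  have h2 : f t * Real.exp (-M * t) < 0 := mul_neg_of_neg_of_pos hneg (Real.exp_pos _)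
  linarith

/-- Sturm comparison for a singular Prüfer equation. The difference `D` of the angles satisfies `D'
≥ -M |D|` plus a nonnegative term proportional to `μ - l`, so `D ≥ 0`; equality at `1` would force
`D = 0` on all of `[0, 1]`, against the strict positivity of that term for small `t`. -/
theorem angle_one_lt (ha : 0 ≤ a) (hK : 0 < K) {l μ : ℝ} (hl : 0 ≤ l) (hlμ : l < μ) :
    angle a K l 1 < angle a K μ 1 := by
  obtain ⟨C₁, hC₁, h₁⟩ := angle_le_mul (a := a) hK l
  obtain ⟨C₂, hC₂, h₂⟩ := angle_le_mul (a := a) hK μ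
  set D := fun t => angle a K μ t - angle a K l t with hD
  have hDc : Continuous D := (continuous_angle_right hK μ).sub (continuous_angle_right hK l)
  have hD0 : D 0 = 0 := by simp [hD, angle_zero]
  set D' := fun t => angleRate a K μ t - angleRate a K l t with hD'
  have hDd : ∀ t, HasDerivAt D (D' t) t := fun t =>
    (hasDerivAt_angle hK μ t).sub (hasDerivAt_angle hK l t)
  set M := l * (1 + a) * (C₁ + C₂) / K + K with hM
  have hlow : ∀ t ∈ Set.Ioo (0 : ℝ) 1, -M * |D t| +
      (μ - l) * ((1 + a * t) / t) / K * Real.sin (angle a K μ t) ^ 2 ≤ D' t := by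
    intro t ht
    have ht0 := ht.1
    have htI : t ∈ Set.Icc (0 : ℝ) 1 := ⟨ht.1.le, ht.2.le⟩
    have b1 := h₁ t htI
    have b2 := h₂ t htI
    set x := angle a K l t
    set y := angle a K μ t
    have e : D' t = (l * ((1 + a * t) / t) / K - K) * (Real.sin (y + x) * Real.sin (D t)) +
        (μ - l) * ((1 + a * t) / t) / K * Real.sin y ^ 2 := by
      have hs : Real.sin (y + x) * Real.sin (D t) = Real.sin y ^ 2 - Real.sin x ^ 2 := by
        simp only [hD]
        rw [Real.sin_add, Real.sin_sub]
        have c1 := Real.sin_sq_add_cos_sq x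
        have c2 := Real.sin_sq_add_cos_sq y
        linear_combination (Real.sin y ^ 2) * c1 - (Real.sin x ^ 2) * c2
      rw [hs]
      simp only [hD', angleRate_eq_trig hK _ ht0]
      rw [Real.cos_sq', Real.cos_sq']
      ring
    -- The singular coefficient stays bounded because the sum of the two angles is at most `(C₁ +
    -- C₂) * t`.
    have hb : |l * ((1 + a * t) / t) / K - K| * |Real.sin (y + x)| ≤ M := by
      have s1 : |Real.sin (y + x)| ≤ (C₁ + C₂) * t :=
        Real.abs_sin_le_abs.trans ((abs_add_le _ _).trans (by linarith))
      have s2 : |Real.sin (y + x)| ≤ 1 := Real.abs_sin_le_one _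
      have hq : 0 ≤ l * ((1 + a * t) / t) / K := by positivity
      have s3 : |l * ((1 + a * t) / t) / K - K| ≤ l * ((1 + a * t) / t) / K + K := by
        rw [abs_le]; constructor <;> linarith
      calc |l * ((1 + a * t) / t) / K - K| * |Real.sin (y + x)|
          ≤ (l * ((1 + a * t) / t) / K + K) * |Real.sin (y + x)| := by gcongr
        _ = l * ((1 + a * t) / t) / K * |Real.sin (y + x)| + K * |Real.sin (y + x)| := by ring
        _ ≤ l * ((1 + a * t) / t) / K * ((C₁ + C₂) * t) + K * 1 := by gcongr
        _ = l * (1 + a * t) * (C₁ + C₂) / K + K := by field_simp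
        _ ≤ M := by
          rw [hM]; gcongr
          exact mul_le_of_le_one_right ha ht.2.le
    have hb2 : |(l * ((1 + a * t) / t) / K - K) * (Real.sin (y + x) * Real.sin (D t))| ≤
        M * |D t| := by
      rw [abs_mul, abs_mul, ← mul_assoc]
      exact mul_le_mul hb Real.abs_sin_le_abs (abs_nonneg _) ((by positivity : (0:ℝ) ≤ _).trans hb)
    rw [e]
    linarith [(abs_le.1 hb2).1]
  have hB : ∀ t ∈ Set.Ioo (0 : ℝ) 1,
      0 ≤ (μ - l) * ((1 + a * t) / t) / K * Real.sin (angle a K μ t) ^ 2 := by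
    intro t ht
    have := ht.1
    have := sub_pos.2 hlμ
    positivity
  have hnn : ∀ t ∈ Set.Icc (0 : ℝ) 1, 0 ≤ D t := fun t ht =>
    nonneg_of_deriv_ge (M := M) hDc hD0 (fun t _ => hDd t)
      (fun t ht => by linarith [hlow t ht, hB t ht]) ht
  have hgrow : ∀ t ∈ Set.Icc (0 : ℝ) 1, D t * Real.exp (M * t) ≤ D 1 * Real.exp (M * 1) :=
    fun t ht => mul_exp_le_of_deriv_ge ht.2 hDc.continuousOn (fun t _ => hDd t) fun x hx => by
      have hx' : x ∈ Set.Ioo (0 : ℝ) 1 := ⟨ht.1.trans_lt hx.1, hx.2⟩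
      have h1 := hlow x hx'
      rw [abs_of_nonneg (hnn x ⟨hx'.1.le, hx'.2.le⟩)] at h1
      linarith [hB x hx']
  by_contra! hle
  have hD1 : D 1 = 0 := le_antisymm (by simp only [hD]; linarith) (hnn 1 (by simp))
  have hDz : ∀ t ∈ Set.Icc (0 : ℝ) 1, D t = 0 := fun t ht => by
    refine le_antisymm ?_ (hnn t ht)
    have := hgrow t ht
    rw [hD1, zero_mul] at this
    exact nonpos_of_mul_nonpos_left this (Real.exp_pos _)
  have hmono := strictMonoOn_angle (a := a) ha hK (hl.trans hlμ.le)
  have hsmall : ∀ᶠ t in nhdsWithin (0 : ℝ) (Set.Ioi 0), angle a K μ t < Real.pi ∧ t < 1 := by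
    refine Filter.Eventually.and ?_ ?_
    · refine Filter.Eventually.filter_mono nhdsWithin_le_nhds ?_
      exact (continuous_angle_right hK μ).continuousAt.eventually_lt_const
        (by rw [angle_zero]; exact Real.pi_pos)
    · exact (eventually_lt_nhds one_pos).filter_mono nhdsWithin_le_nhds
  obtain ⟨t, ⟨htπ, ht1⟩, ht0⟩ := (hsmall.and self_mem_nhdsWithin).exists
  have hpos : 0 < angle a K μ t := by
    simpa [angle_zero] using hmono Set.self_mem_Ici ht0.le ht0
  have hsin := Real.sin_pos_of_pos_of_lt_pi hpos htπ
  have hd0 : D' t = 0 := by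
    have h1 : HasDerivAt D 0 t := (hasDerivAt_const t (0 : ℝ)).congr_of_eventuallyEq
      (Filter.mem_of_superset (Ioo_mem_nhds ht0 ht1) fun x hx => hDz x ⟨hx.1.le, hx.2.le⟩)
    exact (hDd t).unique h1
  have := hlow t ⟨ht0, ht1⟩
  rw [hd0, hDz t ⟨ht0.le, ht1.le⟩] at this
  have h3 := sub_pos.2 hlμ
  have : 0 < (μ - l) * ((1 + a * t) / t) / K * Real.sin (angle a K μ t) ^ 2 := by positivity
  simp at *
  linarith

end

/-! ### Partial derivatives -/

/-- `f` is differentiable at `z` with partial derivatives `p` and `q`. -/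
def HasPartials (f : ℂ → ℝ) (p q : ℝ) (z : ℂ) : Prop :=
  HasFDerivAt f (p • Complex.reCLM + q • Complex.imCLM) z

section

variable {f g : ℂ → ℝ} {p q p' q' : ℝ} {z : ℂ}

theorem HasPartials.congr_partials (h : HasPartials f p q z) (hp : p = p') (hq : q = q') :
    HasPartials f p' q' z := hp ▸ hq ▸ h

theorem hasPartials_const (c : ℝ) : HasPartials (fun _ => c) 0 0 z := by
  simpa [HasPartials] using hasFDerivAt_const c z

theorem hasPartials_re : HasPartials (fun z => z.re) 1 0 z := by
  refine (Complex.reCLM.hasFDerivAt (x := z)).congr_fderiv ?_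
  simp

theorem hasPartials_im : HasPartials (fun z => z.im) 0 1 z := by
  refine (Complex.imCLM.hasFDerivAt (x := z)).congr_fderiv ?_
  simp

theorem HasPartials.add (hf : HasPartials f p q z) (hg : HasPartials g p' q' z) :
    HasPartials (fun z => f z + g z) (p + p') (q + q') z := by
  refine (HasFDerivAt.add hf hg).congr_fderiv ?_
  ext
  simp
  ring

theorem HasPartials.mul (hf : HasPartials f p q z) (hg : HasPartials g p' q' z) :
    HasPartials (fun z => f z * g z) (f z * p' + g z * p) (f z * q' + g z * q) z := by
  refine (HasFDerivAt.mul hf hg).congr_fderiv ?_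
  ext
  simp
  ring

theorem HasPartials.const_mul (c : ℝ) (hf : HasPartials f p q z) :
    HasPartials (fun z => c * f z) (c * p) (c * q) z :=
  ((hasPartials_const c).mul hf).congr_partials (by ring) (by ring)

theorem HasPartials.comp {φ : ℝ → ℝ} {d : ℝ} (hφ : HasDerivAt φ d (f z))
    (hf : HasPartials f p q z) : HasPartials (fun z => φ (f z)) (d * p) (d * q) z := by
  refine (hφ.comp_hasFDerivAt z hf).congr_fderiv ?_
  ext
  simp
  ring

theorem hasPartials_normSq : HasPartials (fun z => Complex.normSq z) (2 * z.re) (2 * z.im) z := by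
  have := (hasPartials_re.mul (hasPartials_re (z := z))).add
    (hasPartials_im.mul (hasPartials_im (z := z)))
  exact HasPartials.congr_partials this (by ring) (by ring)

/-- Makes `dX` and `dY` well determined up to the boundary, so that any full derivative computes
them there. -/
theorem uniqueDiffOn_closedDisc : UniqueDiffOn ℝ closedDisc :=
  uniqueDiffOn_convex (convex_closedBall _ _)
    ((Metric.nonempty_ball.2 one_pos).mono Metric.ball_subset_interior_closedBall)

theorem HasPartials.dX_eq (h : HasPartials f p q z) (hz : z ∈ closedDisc) : dX f z = p := by
  rw [dX, (HasFDerivAt.hasFDerivWithinAt h).fderivWithin (uniqueDiffOn_closedDisc z hz)]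
  simp

theorem HasPartials.dY_eq (h : HasPartials f p q z) (hz : z ∈ closedDisc) : dY f z = q := by
  rw [dY, (HasFDerivAt.hasFDerivWithinAt h).fderivWithin (uniqueDiffOn_closedDisc z hz)]
  simp

theorem dX_congr (h : ∀ z ∈ closedDisc, f z = g z) (hz : z ∈ closedDisc) : dX f z = dX g z := by
  rw [dX, dX, fderivWithin_congr h (h z hz)]

theorem dY_congr (h : ∀ z ∈ closedDisc, f z = g z) (hz : z ∈ closedDisc) : dY f z = dY g z := by
  rw [dY, dY, fderivWithin_congr h (h z hz)]

end

/-! ### The metrics -/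

/-- The squared stretching factor `1 / (1 + a |z|²)` of the metric along circles. -/
noncomputable def circFactor (a : ℝ) (z : ℂ) : ℝ := (1 + a * Complex.normSq z)⁻¹

theorem circFactor_den_pos {a : ℝ} (ha : 0 ≤ a) (z : ℂ) : 0 < 1 + a * Complex.normSq z := by
  have := Complex.normSq_nonneg z
  positivity

theorem circFactor_pos {a : ℝ} (ha : 0 ≤ a) (z : ℂ) : 0 < circFactor a z :=
  inv_pos.2 (circFactor_den_pos ha z)

theorem circFactor_mul {a : ℝ} (ha : 0 ≤ a) (z : ℂ) :
    circFactor a z * (1 + a * (z.re * z.re + z.im * z.im)) = 1 :=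
  inv_mul_cancel₀ (circFactor_den_pos ha z).ne'

theorem contDiff_normSq : ContDiff ℝ ∞ (fun z : ℂ => Complex.normSq z) := by
  have h1 : ContDiff ℝ ∞ (fun z : ℂ => z.re) := Complex.reCLM.contDiff
  have h2 : ContDiff ℝ ∞ (fun z : ℂ => z.im) := Complex.imCLM.contDiff
  exact (h1.mul h1).add (h2.mul h2)

theorem contDiffOn_circFactor_family :
    ContDiffOn ℝ ∞ (fun q : ℝ × ℂ => circFactor q.1 q.2) (Set.Ici 0 ×ˢ Set.univ) := by
  refine ContDiffOn.inv ?_ fun q hq => (circFactor_den_pos hq.1 q.2).ne'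
  exact (contDiff_const.add (contDiff_fst.mul (contDiff_normSq.comp contDiff_snd))).contDiffOn

theorem contDiff_circFactor {a : ℝ} (ha : 0 ≤ a) : ContDiff ℝ ∞ (circFactor a) :=
  ContDiff.inv (contDiff_const.add (contDiff_const.mul contDiff_normSq))
    fun z => (circFactor_den_pos ha z).ne'

theorem contDiff_re : ContDiff ℝ ∞ (fun z : ℂ => z.re) := Complex.reCLM.contDiff

theorem contDiff_im : ContDiff ℝ ∞ (fun z : ℂ => z.im) := Complex.imCLM.contDiff

/-- The eigenvalues are `1 + a |z|²` in the radial direction and its inverse `circFactor a z` in the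
tangential one. -/
theorem det_metric {a : ℝ} (ha : 0 ≤ a) (z : ℂ) :
    (circFactor a z + a * (z.re * z.re) * (1 + circFactor a z)) *
      (circFactor a z + a * (z.im * z.im) * (1 + circFactor a z)) -
      (a * (z.re * z.im) * (1 + circFactor a z)) ^ 2 = 1 := by
  linear_combination (circFactor a z + 1) * circFactor_mul ha z

/-- The rotation invariant metric with unit area density in which the circle of radius `r` has
length `2πr / √(1 + a r²)`. -/
noncomputable def metric (a : ℝ) (ha : 0 ≤ a) : RiemMetric where
  E z := circFactor a z + a * (z.re * z.re) * (1 + circFactor a z)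
  F z := a * (z.re * z.im) * (1 + circFactor a z)
  G z := circFactor a z + a * (z.im * z.im) * (1 + circFactor a z)
  smooth_E := ((contDiff_circFactor ha).add ((contDiff_const.mul (contDiff_re.mul contDiff_re)).mul
    (contDiff_const.add (contDiff_circFactor ha)))).contDiffOn
  smooth_F := ((contDiff_const.mul (contDiff_re.mul contDiff_im)).mul
    (contDiff_const.add (contDiff_circFactor ha))).contDiffOn
  smooth_G := ((contDiff_circFactor ha).add ((contDiff_const.mul (contDiff_im.mul contDiff_im)).mul
    (contDiff_const.add (contDiff_circFactor ha)))).contDiffOn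
  E_pos z _ := by
    have := circFactor_pos ha z
    have := mul_self_nonneg z.re
    positivity
  det_pos z _ := by rw [det_metric ha]; exact one_pos

section

variable {a : ℝ} (ha : 0 ≤ a)

theorem metric_W (z : ℂ) : (metric a ha).W z = 1 := by
  rw [RiemMetric.W, metric, det_metric ha, Real.sqrt_one]

theorem metric_area : (metric a ha).area = Real.pi := by
  rw [RiemMetric.area]
  simp only [metric_W]
  simp [MeasureTheory.measureReal_def, openDisc]

/-- Only inner products of `ξ`, `η` and `z` occur, which makes rotation invariance evident. -/
theorem metric_form (z ξ η : ℂ) : (metric a ha).form z ξ η =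
    circFactor a z * (ξ * (starRingEnd ℂ) η).re + a * (1 + circFactor a z) *
      ((ξ * (starRingEnd ℂ) z).re * (η * (starRingEnd ℂ) z).re) := by
  simp [RiemMetric.form, metric]; ring

theorem metric_isRotationInvariant : (metric a ha).IsRotationInvariant := by
  intro w z _ ξ η
  have key : ∀ x y : ℂ, (w : ℂ) * x * (starRingEnd ℂ) ((w : ℂ) * y) = x * (starRingEnd ℂ) y := by
    intro x y
    have : (w : ℂ) * (starRingEnd ℂ) (w : ℂ) = 1 := by
      rw [Complex.mul_conj]; simp
    rw [map_mul]
    linear_combination (x * (starRingEnd ℂ) y) * this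
  rw [metric_form, metric_form, key, key, key]
  simp [circFactor, Complex.normSq_mul]

theorem hasPartials_circFactor {a : ℝ} (ha : 0 ≤ a) (z : ℂ) : HasPartials (circFactor a)
    (-2 * a * z.re * circFactor a z ^ 2) (-2 * a * z.im * circFactor a z ^ 2) z := by
  have h := ((hasPartials_const 1).add (hasPartials_normSq (z := z) |>.const_mul a)).comp
    (φ := fun x => x⁻¹) (hasDerivAt_inv (circFactor_den_pos ha z).ne')
  refine h.congr_partials ?_ ?_ <;> rw [circFactor, inv_pow] <;> ring

/-- The partials needed again in Brioschi's formula are arranged as nested products, the shape in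
which `HasPartials.mul` differentiates them once more. -/
theorem hasPartials_metric_E (z : ℂ) : HasPartials (metric a ha).E
    (-2 * a * z.re * circFactor a z ^ 2 * (1 + a * (z.re * z.re)) +
      2 * a * z.re * (1 + circFactor a z))
    (-2 * a * (z.im * (circFactor a z * circFactor a z) * (1 + a * (z.re * z.re)))) z := by
  have hv := hasPartials_circFactor ha z
  have h := hv.add (((hasPartials_re.mul (hasPartials_re (z := z))).const_mul a).mul
    ((hasPartials_const 1).add hv))
  exact h.congr_partials (by ring) (by ring)

theorem hasPartials_metric_F (z : ℂ) : HasPartials (metric a ha).F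
    (a * (z.im * (1 + circFactor a z + -2 * a * (z.re * z.re * (circFactor a z * circFactor a z)))))
    (a * (z.re * (1 + circFactor a z + -2 * a * (z.im * z.im * (circFactor a z * circFactor a z)))))
    z := by
  have hv := hasPartials_circFactor ha z
  have h := ((hasPartials_re.mul (hasPartials_im (z := z))).const_mul a).mul
    ((hasPartials_const 1).add hv)
  exact h.congr_partials (by ring) (by ring)

theorem hasPartials_metric_G (z : ℂ) : HasPartials (metric a ha).G
    (-2 * a * (z.re * (circFactor a z * circFactor a z) * (1 + a * (z.im * z.im))))
    (-2 * a * z.im * circFactor a z ^ 2 * (1 + a * (z.im * z.im)) +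
      2 * a * z.im * (1 + circFactor a z)) z := by
  have hv := hasPartials_circFactor ha z
  have h := hv.add (((hasPartials_im.mul (hasPartials_im (z := z))).const_mul a).mul
    ((hasPartials_const 1).add hv))
  exact h.congr_partials (by ring) (by ring)

theorem dY_dY_metric_E {z : ℂ} (hz : z ∈ closedDisc) : dY (dY (metric a ha).E) z =
    -2 * a * (1 + a * (z.re * z.re)) *
      (circFactor a z ^ 2 - 4 * a * z.im ^ 2 * circFactor a z ^ 3) := by
  rw [dY_congr (fun w hw => (hasPartials_metric_E ha w).dY_eq hw) hz]
  have hv := hasPartials_circFactor ha z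
  have h := (((hasPartials_im (z := z)).mul (hv.mul hv)).mul ((hasPartials_const 1).add
    ((hasPartials_re.mul (hasPartials_re (z := z))).const_mul a))).const_mul (-2 * a)
  rw [h.dY_eq hz]
  ring

theorem dX_dX_metric_G {z : ℂ} (hz : z ∈ closedDisc) : dX (dX (metric a ha).G) z =
    -2 * a * (1 + a * (z.im * z.im)) *
      (circFactor a z ^ 2 - 4 * a * z.re ^ 2 * circFactor a z ^ 3) := by
  rw [dX_congr (fun w hw => (hasPartials_metric_G ha w).dX_eq hw) hz]
  have hv := hasPartials_circFactor ha z
  have h := (((hasPartials_re (z := z)).mul (hv.mul hv)).mul ((hasPartials_const 1).add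
    ((hasPartials_im.mul (hasPartials_im (z := z))).const_mul a))).const_mul (-2 * a)
  rw [h.dX_eq hz]
  ring

theorem dY_dX_metric_F {z : ℂ} (hz : z ∈ closedDisc) : dY (dX (metric a ha).F) z =
    a * (1 + circFactor a z) - 2 * a ^ 2 * z.im ^ 2 * circFactor a z ^ 2 -
      2 * a ^ 2 * z.re ^ 2 * (circFactor a z ^ 2 - 4 * a * z.im ^ 2 * circFactor a z ^ 3) := by
  rw [dY_congr (fun w hw => (hasPartials_metric_F ha w).dX_eq hw) hz]
  have hv := hasPartials_circFactor ha z
  have h := ((hasPartials_im (z := z)).mul (((hasPartials_const 1).add hv).add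
    (((hasPartials_re.mul (hasPartials_re (z := z))).mul (hv.mul hv)).const_mul
      (-2 * a)))).const_mul a
  rw [h.dY_eq hz]
  ring

theorem metric_curvature {z : ℂ} (hz : z ∈ closedDisc) :
    (metric a ha).curvature z = 4 * a * circFactor a z ^ 3 := by
  have hd : (metric a ha).E z * (metric a ha).G z - (metric a ha).F z ^ 2 = 1 := det_metric ha z
  rw [RiemMetric.curvature, hd, dY_dY_metric_E ha hz, dX_dX_metric_G ha hz, dY_dX_metric_F ha hz,
    (hasPartials_metric_E ha z).dX_eq hz, (hasPartials_metric_E ha z).dY_eq hz,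
    (hasPartials_metric_F ha z).dX_eq hz, (hasPartials_metric_F ha z).dY_eq hz,
    (hasPartials_metric_G ha z).dX_eq hz, (hasPartials_metric_G ha z).dY_eq hz,
    Matrix.det_fin_three, Matrix.det_fin_three]
  simp only [metric, circFactor, Complex.normSq_apply]
  have hpos := circFactor_den_pos ha z
  rw [Complex.normSq_apply] at hpos
  generalize z.re = x at *
  generalize z.im = y at *
  simp [Matrix.of_apply]
  field_simp
  ring

/-! ### The Laplacian on radial functions -/

/-- The last bracket is an angular derivative of `u`; it drops out for radial functions. -/
theorem metric_fluxX (u : ℂ → ℝ) (z : ℂ) : (metric a ha).fluxX u z =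
    circFactor a z * dX u z + a * (1 + circFactor a z) * z.im *
      (z.im * dX u z - z.re * dY u z) := by
  rw [RiemMetric.fluxX, metric_W]; simp only [metric]; ring

theorem metric_fluxY (u : ℂ → ℝ) (z : ℂ) : (metric a ha).fluxY u z =
    circFactor a z * dY u z + a * (1 + circFactor a z) * z.re *
      (z.re * dY u z - z.im * dX u z) := by
  rw [RiemMetric.fluxY, metric_W]; simp only [metric]; ring

end

/-- The rotation invariant function with profile `radialSol a l`. -/
noncomputable def radialFun (a l : ℝ) (z : ℂ) : ℝ := radialSol a l (Complex.normSq z)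

theorem contDiff_radialFun (a l : ℝ) : ContDiff ℝ ∞ (radialFun a l) :=
  (contDiff_radialSol a l).comp contDiff_normSq

theorem radialSol_eq_add (a l t : ℝ) : radialSol a l t = sol a l t + t * deriv (sol a l) t := by
  have h := (hasDerivAt_id t).mul
    ((contDiff_sol a l).differentiable (by simp) t).hasDerivAt
  have := (hasDerivAt_primSol a l t).unique h
  simpa using this

theorem hasPartials_radialFun (a l : ℝ) (z : ℂ) : HasPartials (radialFun a l)
    (-l * (1 + a * Complex.normSq z) * sol a l (Complex.normSq z) * (2 * z.re))
    (-l * (1 + a * Complex.normSq z) * sol a l (Complex.normSq z) * (2 * z.im)) z :=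
  hasPartials_normSq.comp (hasDerivAt_radialSol a l _)

section

variable {a : ℝ} (ha : 0 ≤ a) (l : ℝ)

/-- The factor `1 + a |z|²` in `φ'` cancels `circFactor`, leaving the smooth field `-2 l σ(|z|²) z`.
Its divergence is `-4 l (σ + t σ') = -4 l φ`, whence the eigenvalue `4 l`. -/
theorem fluxX_radialFun {z : ℂ} (hz : z ∈ closedDisc) : (metric a ha).fluxX (radialFun a l) z =
    -2 * l * (z.re * sol a l (Complex.normSq z)) := by
  have hp := hasPartials_radialFun a l z
  have hv := circFactor_mul ha z
  rw [metric_fluxX, hp.dX_eq hz, hp.dY_eq hz]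
  simp only [Complex.normSq_apply] at *
  linear_combination (-l * sol a l (z.re * z.re + z.im * z.im) * 2 * z.re) * hv

theorem fluxY_radialFun {z : ℂ} (hz : z ∈ closedDisc) : (metric a ha).fluxY (radialFun a l) z =
    -2 * l * (z.im * sol a l (Complex.normSq z)) := by
  have hp := hasPartials_radialFun a l z
  have hv := circFactor_mul ha z
  rw [metric_fluxY, hp.dX_eq hz, hp.dY_eq hz]
  simp only [Complex.normSq_apply] at *
  linear_combination (-l * sol a l (z.re * z.re + z.im * z.im) * 2 * z.im) * hv

theorem laplacian_radialFun {z : ℂ} (hz : z ∈ closedDisc) :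
    (metric a ha).laplacian (radialFun a l) z = -(4 * l) * radialFun a l z := by
  have hs : HasPartials (fun z => sol a l (Complex.normSq z)) _ _ z :=
    hasPartials_normSq.comp ((contDiff_sol a l).differentiable (by simp) _).hasDerivAt
  rw [RiemMetric.laplacian, metric_W, dX_congr (fun w hw => fluxX_radialFun ha l hw) hz,
    dY_congr (fun w hw => fluxY_radialFun ha l hw) hz,
    ((hasPartials_re.mul hs).const_mul (-2 * l)).dX_eq hz,
    ((hasPartials_im.mul hs).const_mul (-2 * l)).dY_eq hz, radialFun, radialSol_eq_add,
    Complex.normSq_apply]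
  ring

theorem conormalDeriv_radialFun {z : ℂ} (hz : ‖z‖ = 1) :
    (metric a ha).conormalDeriv (radialFun a l) z = -2 * l * primSol a l 1 := by
  have hz' : z ∈ closedDisc := by simp [closedDisc, hz]
  have hn : Complex.normSq z = 1 := by rw [Complex.normSq_eq_norm_sq, hz, one_pow]
  rw [RiemMetric.conormalDeriv, fluxX_radialFun ha l hz', fluxY_radialFun ha l hz', primSol, hn]
  rw [Complex.normSq_apply] at hn
  linear_combination (-2 * l * sol a l 1) * hn

/-- The boundary condition for the radial solution, in terms of the parameter. -/
def RadialBoundary (a : ℝ) (b : BoundaryCondition) (l : ℝ) : Prop :=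
  match b with
  -- The conormal derivative carries a factor `l`, so constants qualify whatever the value of `s` at
  -- `1`.
  | .neumann => l = 0 ∨ primSol a l 1 = 0
  | .dirichlet => radialSol a l 1 = 0

theorem isEigenfunction_radialFun {b : BoundaryCondition} (hb : RadialBoundary a b l) :
    IsEigenfunction (metric a ha) b (4 * l) (radialFun a l) where
  contDiff_interior := ((contDiff_radialFun a l).of_le (WithTop.coe_le_coe.2 le_top)).contDiffOn
  contDiff_closed := ((contDiff_radialFun a l).of_le (WithTop.coe_le_coe.2 le_top)).contDiffOn
  ne_zero := ⟨0, by simp, by simp [radialFun, radialSol_zero]⟩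
  equation z hz := by
    rw [laplacian_radialFun ha l (Metric.ball_subset_closedBall hz)]; ring
  boundary := by
    cases b with
    | neumann =>
      intro z hz
      rw [conormalDeriv_radialFun ha l hz]
      rcases hb with h | h <;> simp [h]
    | dirichlet =>
      intro z hz
      rw [radialFun, Complex.normSq_eq_norm_sq, hz, one_pow]
      exact hb

end

/-! ### Polar coordinates -/

/-- The point with polar coordinates `r`, `θ`. -/
noncomputable def polarPt (r θ : ℝ) : ℂ := ⟨r * Real.cos θ, r * Real.sin θ⟩

theorem normSq_polarPt (r θ : ℝ) : Complex.normSq (polarPt r θ) = r ^ 2 := by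
  rw [Complex.normSq_apply, polarPt]
  linear_combination r ^ 2 * Real.sin_sq_add_cos_sq θ

theorem norm_polarPt {r : ℝ} (hr : 0 ≤ r) (θ : ℝ) : ‖polarPt r θ‖ = r := by
  have h := normSq_polarPt r θ
  rw [Complex.normSq_eq_norm_sq] at h
  exact (pow_left_inj₀ (norm_nonneg _) hr two_ne_zero).1 h

theorem polarPt_mem_closedDisc {r : ℝ} (hr : r ∈ Set.Icc (0 : ℝ) 1) (θ : ℝ) :
    polarPt r θ ∈ closedDisc := by
  simpa [closedDisc, norm_polarPt hr.1] using hr.2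

theorem polarPt_mem_openDisc {r : ℝ} (hr : r ∈ Set.Ioo (0 : ℝ) 1) (θ : ℝ) :
    polarPt r θ ∈ openDisc := by
  simpa [openDisc, norm_polarPt hr.1.le] using hr.2

theorem polarPt_norm_arg (z : ℂ) : polarPt ‖z‖ z.arg = z :=
  Complex.ext (Complex.norm_mul_cos_arg z) (Complex.norm_mul_sin_arg z)

theorem polarPt_add_two_pi (r θ : ℝ) : polarPt r (θ + 2 * Real.pi) = polarPt r θ := by
  simp [polarPt]

theorem continuous_polarPt : Continuous fun q : ℝ × ℝ => polarPt q.1 q.2 := by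
  have : (fun q : ℝ × ℝ => polarPt q.1 q.2) = fun q : ℝ × ℝ =>
      Complex.equivRealProdCLM.symm (q.1 * Real.cos q.2, q.1 * Real.sin q.2) := rfl
  rw [this]
  fun_prop

section

variable {f : ℂ → ℝ} {p q r θ : ℝ}

theorem HasPartials.hasDerivAt_radius (h : HasPartials f p q (polarPt r θ)) :
    HasDerivAt (fun r => f (polarPt r θ)) (p * Real.cos θ + q * Real.sin θ) r := by
  have hγ : HasDerivAt (fun r => polarPt r θ)
      (Complex.equivRealProdCLM.symm (Real.cos θ, Real.sin θ)) r := by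
    refine Complex.equivRealProdCLM.symm.hasFDerivAt.comp_hasDerivAt r
      (f := fun r : ℝ => (r * Real.cos θ, r * Real.sin θ)) ?_
    simpa using ((hasDerivAt_id r).mul_const (Real.cos θ)).prodMk
      ((hasDerivAt_id r).mul_const (Real.sin θ))
  refine (HasFDerivAt.comp_hasDerivAt r (f := fun r => polarPt r θ) h hγ).congr_deriv ?_
  simp

theorem HasPartials.hasDerivAt_angle (h : HasPartials f p q (polarPt r θ)) :
    HasDerivAt (fun θ => f (polarPt r θ)) (p * (r * -Real.sin θ) + q * (r * Real.cos θ)) θ := by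
  have hγ : HasDerivAt (fun θ => polarPt r θ)
      (Complex.equivRealProdCLM.symm (r * -Real.sin θ, r * Real.cos θ)) θ := by
    refine Complex.equivRealProdCLM.symm.hasFDerivAt.comp_hasDerivAt θ
      (f := fun θ : ℝ => (r * Real.cos θ, r * Real.sin θ)) ?_
    exact ((Real.hasDerivAt_cos θ).const_mul r).prodMk ((Real.hasDerivAt_sin θ).const_mul r)
  refine (HasFDerivAt.comp_hasDerivAt θ h hγ).congr_deriv ?_
  simp

end

/-! ### Regularity of partial derivatives -/

theorem closedDisc_mem_nhds {z : ℂ} (hz : z ∈ openDisc) : closedDisc ∈ nhds z :=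
  Filter.mem_of_superset (Metric.isOpen_ball.mem_nhds hz) Metric.ball_subset_closedBall

theorem hasPartials_of_differentiableAt {f : ℂ → ℝ} {z : ℂ} (hz : z ∈ openDisc)
    (hf : DifferentiableAt ℝ f z) : HasPartials f (dX f z) (dY f z) z := by
  refine hf.hasFDerivAt.congr_fderiv ?_
  rw [dX, dY, fderivWithin_of_mem_nhds (closedDisc_mem_nhds hz)]
  ext w
  conv_lhs => rw [← Complex.re_add_im w]
  have : (w.re : ℂ) + w.im * Complex.I = w.re • (1 : ℂ) + w.im • Complex.I := by simp
  rw [this, map_add, map_smul, map_smul]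
  simp [mul_comm]

theorem contDiffOn_partials {f : ℂ → ℝ} (hf : ContDiffOn ℝ 2 f openDisc) :
    ContDiffOn ℝ 1 (dX f) openDisc ∧ ContDiffOn ℝ 1 (dY f) openDisc := by
  have h := hf.fderiv_of_isOpen Metric.isOpen_ball (m := 1) (by norm_num)
  constructor
  · refine (h.clm_apply (contDiffOn_const (c := (1 : ℂ)))).congr fun z hz => ?_
    rw [dX, fderivWithin_of_mem_nhds (closedDisc_mem_nhds hz)]
  · refine (h.clm_apply (contDiffOn_const (c := Complex.I))).congr fun z hz => ?_
    rw [dY, fderivWithin_of_mem_nhds (closedDisc_mem_nhds hz)]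

theorem continuousOn_partials_openDisc {f : ℂ → ℝ} (hf : ContDiffOn ℝ 1 f openDisc) :
    ContinuousOn (dX f) openDisc ∧ ContinuousOn (dY f) openDisc := by
  have h := hf.continuousOn_fderiv_of_isOpen Metric.isOpen_ball le_rfl
  constructor
  · refine (h.clm_apply (continuousOn_const (c := (1 : ℂ)))).congr fun z hz => ?_
    rw [dX, fderivWithin_of_mem_nhds (closedDisc_mem_nhds hz)]
  · refine (h.clm_apply (continuousOn_const (c := Complex.I))).congr fun z hz => ?_
    rw [dY, fderivWithin_of_mem_nhds (closedDisc_mem_nhds hz)]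

theorem continuousOn_partials_closedDisc {f : ℂ → ℝ} (hf : ContDiffOn ℝ 1 f closedDisc) :
    ContinuousOn (dX f) closedDisc ∧ ContinuousOn (dY f) closedDisc := by
  have h := hf.continuousOn_fderivWithin uniqueDiffOn_closedDisc le_rfl
  exact ⟨h.clm_apply continuousOn_const, h.clm_apply continuousOn_const⟩

/-! ### Integrals depending on a parameter -/

theorem continuousOn_integral_param {F : ℝ → ℝ → ℝ}
    (hF : ContinuousOn (fun q : ℝ × ℝ => F q.1 q.2) (Set.Icc 0 1 ×ˢ Set.univ)) (T : ℝ) :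
    ContinuousOn (fun r => ∫ θ in (0 : ℝ)..T, F r θ) (Set.Icc 0 1) := by
  -- Clamping the radius to `[0, 1]` extends the integrand continuously to the whole plane.
  set p : ℝ → ℝ := fun r => max 0 (min r 1)
  have hp : ∀ r, p r ∈ Set.Icc (0 : ℝ) 1 := fun r =>
    ⟨le_max_left _ _, max_le zero_le_one (min_le_right _ _)⟩
  have hc : Continuous fun q : ℝ × ℝ => F (p q.1) q.2 :=
    hF.comp_continuous (f := fun q : ℝ × ℝ => (p q.1, q.2)) (by fun_prop)
      fun q => ⟨hp _, Set.mem_univ _⟩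
  have := intervalIntegral.continuous_parametric_intervalIntegral_of_continuous'
    (μ := MeasureTheory.volume) (f := fun r θ => F (p r) θ) hc 0 T
  refine this.continuousOn.congr fun r hr => ?_
  simp only [p, min_eq_left hr.2, max_eq_right hr.1]

theorem hasDerivAt_integral_param {F F' : ℝ → ℝ → ℝ} {T : ℝ}
    (hF : ∀ r ∈ Set.Ioo (0 : ℝ) 1, Continuous (F r))
    (hF' : ContinuousOn (fun q : ℝ × ℝ => F' q.1 q.2) (Set.Ioo 0 1 ×ˢ Set.univ))
    (hd : ∀ r ∈ Set.Ioo (0 : ℝ) 1, ∀ θ, HasDerivAt (fun r => F r θ) (F' r θ) r) {r : ℝ}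
    (hr : r ∈ Set.Ioo (0 : ℝ) 1) :
    HasDerivAt (fun r => ∫ θ in (0 : ℝ)..T, F r θ) (∫ θ in (0 : ℝ)..T, F' r θ) r := by
  obtain ⟨ε, hε, hball⟩ := Metric.nhds_basis_closedBall.mem_iff.1 (isOpen_Ioo.mem_nhds hr)
  obtain ⟨C, hC⟩ := ((isCompact_closedBall r ε).prod (isCompact_uIcc (a := 0) (b := T)))
    |>.exists_bound_of_continuousOn (hF'.mono (Set.prod_mono hball (Set.subset_univ _)))
  have hF'r : Continuous (F' r) :=
    hF'.comp_continuous (f := fun θ => (r, θ)) (by fun_prop) fun θ => ⟨hr, Set.mem_univ _⟩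
  refine (intervalIntegral.hasDerivAt_integral_of_dominated_loc_of_deriv_le
    (bound := fun _ => C) (Metric.closedBall_mem_nhds r hε) ?_
    ((hF r hr).intervalIntegrable _ _) hF'r.aestronglyMeasurable ?_ (by simp) ?_).2
  · filter_upwards [isOpen_Ioo.mem_nhds hr] with x hx
    exact (hF x hx).aestronglyMeasurable
  · refine Filter.Eventually.of_forall fun θ hθ x hx => ?_
    exact hC (x, θ) ⟨hx, Set.uIoc_subset_uIcc hθ⟩
  · exact Filter.Eventually.of_forall fun θ _ x hx => hd x (hball hx) θ

/-! ### Pairs of functions solving `c' = A q`, `q' = B c` -/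

/-- Solutions on `(0, 1)` of the linear system `c' = A q`, `q' = B c`, continuous on `[0, 1]`, with
`q` vanishing at `0`. -/
structure SolvesSystem (A B c q : ℝ → ℝ) : Prop where
  cont_fst : ContinuousOn c (Set.Icc 0 1)
  cont_snd : ContinuousOn q (Set.Icc 0 1)
  deriv_fst : ∀ r ∈ Set.Ioo (0 : ℝ) 1, HasDerivAt c (A r * q r) r
  deriv_snd : ∀ r ∈ Set.Ioo (0 : ℝ) 1, HasDerivAt q (B r * c r) r
  snd_zero : q 0 = 0

theorem eqOn_Icc_of_eqOn_Ioo {f g : ℝ → ℝ} (hf : ContinuousOn f (Set.Icc 0 1))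
    (hg : ContinuousOn g (Set.Icc 0 1)) (h : Set.EqOn f g (Set.Ioo 0 1)) :
    Set.EqOn f g (Set.Icc 0 1) :=
  h.of_subset_closure hf hg Set.Ioo_subset_Icc_self (closure_Ioo zero_ne_one).ge

/-- The product `c q` has derivative `A q² + B c² ≥ 0` and vanishes at both ends; hence it is zero,
and so is its derivative. -/
theorem SolvesSystem.energy {A B c q : ℝ → ℝ} (h : SolvesSystem A B c q)
    (hA : ∀ r ∈ Set.Ioo (0 : ℝ) 1, 0 < A r) (hB : ∀ r ∈ Set.Ioo (0 : ℝ) 1, 0 < B r)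
    (h1 : c 1 * q 1 = 0) : ∀ r ∈ Set.Icc (0 : ℝ) 1, c r = 0 := by
  have hd : ∀ r ∈ Set.Ioo (0 : ℝ) 1, HasDerivAt (fun r => c r * q r)
      (A r * q r ^ 2 + B r * c r ^ 2) r := fun r hr =>
    ((h.deriv_fst r hr).mul (h.deriv_snd r hr)).congr_deriv (by ring)
  have hmono : MonotoneOn (fun r => c r * q r) (Set.Icc 0 1) := by
    refine monotoneOn_of_deriv_nonneg (convex_Icc _ _) (h.cont_fst.mul h.cont_snd) ?_ ?_
    · rw [interior_Icc]
      exact fun r hr => (hd r hr).differentiableAt.differentiableWithinAt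
    · rw [interior_Icc]
      intro r hr
      rw [(hd r hr).deriv]
      have := hA r hr
      have := hB r hr
      positivity
  have hz : ∀ r ∈ Set.Icc (0 : ℝ) 1, c r * q r = 0 := fun r hr => by
    have l := hmono (Set.left_mem_Icc.2 zero_le_one) hr hr.1
    have u := hmono hr (Set.right_mem_Icc.2 zero_le_one) hr.2
    simp only [h.snd_zero, mul_zero, h1] at l u
    exact le_antisymm u l
  refine eqOn_Icc_of_eqOn_Ioo h.cont_fst (g := fun _ => 0) continuousOn_const fun r hr => ?_
  have h0 : HasDerivAt (fun r => c r * q r) 0 r :=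
    (hasDerivAt_const r (0 : ℝ)).congr_of_eventuallyEq
    (Filter.mem_of_superset (Ioo_mem_nhds hr.1 hr.2) fun x hx => hz x ⟨hx.1.le, hx.2.le⟩)
  have e := (hd r hr).unique h0
  have p1 := mul_nonneg (hA r hr).le (sq_nonneg (q r))
  have p2 := mul_nonneg (hB r hr).le (sq_nonneg (c r))
  have : B r * c r ^ 2 = 0 := by linarith
  simpa [(hB r hr).ne'] using this

theorem eqOn_const_of_hasDerivAt_zero {f : ℝ → ℝ} (h : ∀ r ∈ Set.Ioo (0 : ℝ) 1, HasDerivAt f 0 r) :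
    ∃ k, ∀ r ∈ Set.Ioo (0 : ℝ) 1, f r = k :=
  isOpen_Ioo.exists_is_const_of_deriv_eq_zero isPreconnected_Ioo
    (fun r hr => (h r hr).differentiableAt.differentiableWithinAt) fun r hr => (h r hr).deriv

/-- Uniqueness up to scaling in spite of the singular coefficients: the Wronskian is constant, and
it is zero because both `q` and `Q` vanish at `0`. -/
theorem SolvesSystem.proportional {A B c q C Q : ℝ → ℝ} (h : SolvesSystem A B c q)
    (H : SolvesSystem A B C Q) (hne : ∀ r ∈ Set.Ioo (0 : ℝ) 1, 0 < C r ^ 2 + Q r ^ 2) :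
    ∃ k, ∀ r ∈ Set.Icc (0 : ℝ) 1, c r = k * C r ∧ q r = k * Q r := by
  have hw : ∀ r ∈ Set.Ioo (0 : ℝ) 1, HasDerivAt (fun r => c r * Q r - q r * C r) 0 r := fun r hr =>
    (((h.deriv_fst r hr).mul (H.deriv_snd r hr)).sub
      ((h.deriv_snd r hr).mul (H.deriv_fst r hr))).congr_deriv (by ring)
  obtain ⟨k₀, hk₀⟩ := eqOn_const_of_hasDerivAt_zero hw
  have hk₀' : ∀ r ∈ Set.Icc (0 : ℝ) 1, c r * Q r - q r * C r = k₀ :=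
    eqOn_Icc_of_eqOn_Ioo ((h.cont_fst.mul H.cont_snd).sub (h.cont_snd.mul H.cont_fst))
      (g := fun _ => k₀) continuousOn_const hk₀
  have hk00 : k₀ = 0 := by
    rw [← hk₀' 0 (by simp), h.snd_zero, H.snd_zero]; ring
  have hpar : ∀ r ∈ Set.Ioo (0 : ℝ) 1, c r * Q r = q r * C r := fun r hr => by
    linarith [hk₀ r hr]
  -- The factor is obtained as a projection onto `(C, Q)`, which makes sense even where one of the
  -- two components vanishes.
  have hm : ∀ r ∈ Set.Ioo (0 : ℝ) 1,
      HasDerivAt (fun r => (c r * C r + q r * Q r) / (C r ^ 2 + Q r ^ 2)) 0 r := by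
    intro r hr
    have d1 := h.deriv_fst r hr
    have d2 := h.deriv_snd r hr
    have D1 := H.deriv_fst r hr
    have D2 := H.deriv_snd r hr
    have := ((d1.mul D1).add (d2.mul D2)).div ((D1.pow 2).add (D2.pow 2)) (hne r hr).ne'
    refine this.congr_deriv ?_
    rw [div_eq_zero_iff]
    left
    have e := hpar r hr
    simp
    linear_combination ((B r + A r) * (Q r ^ 2 - C r ^ 2)) * e
  obtain ⟨k, hk⟩ := eqOn_const_of_hasDerivAt_zero hm
  refine ⟨k, fun r hr => ⟨?_, ?_⟩⟩
  · refine eqOn_Icc_of_eqOn_Ioo h.cont_fst (g := fun r => k * C r)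
      (continuousOn_const.mul H.cont_fst) (fun r hr => ?_) hr
    have := hne r hr
    have e := hpar r hr
    simp only [← hk r hr]
    field_simp
    linear_combination Q r * e
  · refine eqOn_Icc_of_eqOn_Ioo h.cont_snd (g := fun r => k * Q r)
      (continuousOn_const.mul H.cont_snd) (fun r hr => ?_) hr
    have := hne r hr
    have e := hpar r hr
    simp only [← hk r hr]
    field_simp
    linear_combination -C r * e

/-! ### Fourier coefficients of eigenfunctions -/

/-- `e` is a `2π`-periodic solution of `e'' = -κ e` with derivative `e₁`. -/
structure IsTrigWeight (κ : ℝ) (e e₁ : ℝ → ℝ) : Prop where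
  deriv_fst : ∀ θ, HasDerivAt e (e₁ θ) θ
  deriv_snd : ∀ θ, HasDerivAt e₁ (-κ * e θ) θ
  periodic_fst : e (2 * Real.pi) = e 0
  periodic_snd : e₁ (2 * Real.pi) = e₁ 0

theorem isTrigWeight_one : IsTrigWeight 0 (fun _ => 1) (fun _ => 0) where
  deriv_fst θ := hasDerivAt_const θ 1
  deriv_snd θ := by simpa using hasDerivAt_const θ (0 : ℝ)
  periodic_fst := rfl
  periodic_snd := rfl

theorem isTrigWeight_cos (n : ℤ) : IsTrigWeight ((n : ℝ) ^ 2) (fun θ => Real.cos (n * θ))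
    (fun θ => -n * Real.sin (n * θ)) where
  deriv_fst θ := (((hasDerivAt_id θ).const_mul (n : ℝ)).cos).congr_deriv (by simp; ring)
  deriv_snd θ := ((((hasDerivAt_id θ).const_mul (n : ℝ)).sin).const_mul (-n : ℝ)).congr_deriv
    (by simp; ring)
  periodic_fst := by simp [Real.cos_int_mul_two_pi]
  periodic_snd := by
    have : Real.sin (n * (2 * Real.pi)) = 0 := by
      simpa using Real.sin_add_int_mul_two_pi 0 n
    simp [this]

theorem isTrigWeight_sin (n : ℤ) : IsTrigWeight ((n : ℝ) ^ 2) (fun θ => Real.sin (n * θ))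
    (fun θ => n * Real.cos (n * θ)) where
  deriv_fst θ := (((hasDerivAt_id θ).const_mul (n : ℝ)).sin).congr_deriv (by simp; ring)
  deriv_snd θ := ((((hasDerivAt_id θ).const_mul (n : ℝ)).cos).const_mul (n : ℝ)).congr_deriv
    (by simp; ring)
  periodic_fst := by
    have : Real.sin (n * (2 * Real.pi)) = 0 := by
      simpa using Real.sin_add_int_mul_two_pi 0 n
    simp [this]
  periodic_snd := by simp [Real.cos_int_mul_two_pi]

theorem IsTrigWeight.continuous_fst {κ : ℝ} {e e₁ : ℝ → ℝ} (h : IsTrigWeight κ e e₁) :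
    Continuous e :=
  continuous_iff_continuousAt.2 fun θ => (h.deriv_fst θ).continuousAt

theorem IsTrigWeight.continuous_snd {κ : ℝ} {e e₁ : ℝ → ℝ} (h : IsTrigWeight κ e e₁) :
    Continuous e₁ :=
  continuous_iff_continuousAt.2 fun θ => (h.deriv_snd θ).continuousAt

/-- The integral of `u` against the weight `e` on the circle of radius `r`. -/
noncomputable def circleCoeff (u : ℂ → ℝ) (e : ℝ → ℝ) (r : ℝ) : ℝ :=
  ∫ θ in (0 : ℝ)..2 * Real.pi, u (polarPt r θ) * e θ

/-- The integral of the radial flux of `u` against the weight `e` on the circle of radius `r`. -/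
noncomputable def circleFlux (g : RiemMetric) (u : ℂ → ℝ) (e : ℝ → ℝ) (r : ℝ) : ℝ :=
  r * ∫ θ in (0 : ℝ)..2 * Real.pi, (g.fluxX u (polarPt r θ) * Real.cos θ +
    g.fluxY u (polarPt r θ) * Real.sin θ) * e θ

theorem polar_comp_continuousOn_Icc {f : ℂ → ℝ} (hf : ContinuousOn f closedDisc) :
    ContinuousOn (fun q : ℝ × ℝ => f (polarPt q.1 q.2)) (Set.Icc 0 1 ×ˢ Set.univ) :=
  hf.comp continuous_polarPt.continuousOn fun q hq => polarPt_mem_closedDisc hq.1 q.2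

theorem polar_comp_continuousOn_Ioo {f : ℂ → ℝ} (hf : ContinuousOn f openDisc) :
    ContinuousOn (fun q : ℝ × ℝ => f (polarPt q.1 q.2)) (Set.Ioo 0 1 ×ˢ Set.univ) :=
  hf.comp continuous_polarPt.continuousOn fun q hq => polarPt_mem_openDisc hq.1 q.2

theorem polar_comp_continuous {f : ℂ → ℝ} (hf : ContinuousOn f closedDisc) {r : ℝ}
    (hr : r ∈ Set.Icc (0 : ℝ) 1) : Continuous fun θ => f (polarPt r θ) :=
  (polar_comp_continuousOn_Icc hf).comp_continuous (f := fun θ => (r, θ)) (by fun_prop)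
    fun θ => ⟨hr, Set.mem_univ _⟩

theorem circFactor_polarPt (a r θ : ℝ) : circFactor a (polarPt r θ) = (1 + a * r ^ 2)⁻¹ := by
  rw [circFactor, normSq_polarPt]

/-! ### Differential equations for the circle coefficients -/

section

variable {a : ℝ} (ha : 0 ≤ a) {u : ℂ → ℝ}

/-- The polar frame diagonalizes the metric, so the radial and the tangential flux decouple, with
mutually inverse factors. -/
theorem radial_flux_polarPt (r θ : ℝ) :
    (metric a ha).fluxX u (polarPt r θ) * Real.cos θ +
        (metric a ha).fluxY u (polarPt r θ) * Real.sin θ =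
      (1 + a * r ^ 2)⁻¹ * (dX u (polarPt r θ) * Real.cos θ + dY u (polarPt r θ) * Real.sin θ) := by
  rw [metric_fluxX, metric_fluxY, circFactor_polarPt]
  simp only [polarPt]
  ring

theorem tangential_flux_polarPt (r θ : ℝ) :
    -(metric a ha).fluxX u (polarPt r θ) * Real.sin θ +
        (metric a ha).fluxY u (polarPt r θ) * Real.cos θ =
      (1 + a * r ^ 2) *
        (-dX u (polarPt r θ) * Real.sin θ + dY u (polarPt r θ) * Real.cos θ) := by
  have hv : (1 + a * r ^ 2)⁻¹ * (1 + a * r ^ 2) = 1 := inv_mul_cancel₀ (by positivity)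
  rw [metric_fluxX, metric_fluxY, circFactor_polarPt]
  generalize dX u (polarPt r θ) = p
  generalize dY u (polarPt r θ) = q
  have hc := Real.sin_sq_add_cos_sq θ
  simp only [polarPt]
  generalize (1 + a * r ^ 2)⁻¹ = v at *
  linear_combination (-p * Real.sin θ + q * Real.cos θ) * (hv + a * (1 + v) * r ^ 2 * hc)

theorem continuousOn_flux (hu : ContDiffOn ℝ 1 u closedDisc) :
    ContinuousOn ((metric a ha).fluxX u) closedDisc ∧
      ContinuousOn ((metric a ha).fluxY u) closedDisc := by
  obtain ⟨h1, h2⟩ := continuousOn_partials_closedDisc hu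
  have hv := (contDiff_circFactor ha).continuous.continuousOn (s := closedDisc)
  have hre := Complex.continuous_re.continuousOn (s := closedDisc)
  have him := Complex.continuous_im.continuousOn (s := closedDisc)
  constructor
  · rw [show (metric a ha).fluxX u = _ from funext (metric_fluxX ha u)]
    fun_prop
  · rw [show (metric a ha).fluxY u = _ from funext (metric_fluxY ha u)]
    fun_prop

theorem contDiffOn_flux (hu : ContDiffOn ℝ 2 u openDisc) :
    ContDiffOn ℝ 1 ((metric a ha).fluxX u) openDisc ∧
      ContDiffOn ℝ 1 ((metric a ha).fluxY u) openDisc := by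
  obtain ⟨h1, h2⟩ := contDiffOn_partials hu
  have hle : (1 : WithTop ℕ∞) ≤ ∞ := WithTop.coe_le_coe.2 le_top
  have hv := ((contDiff_circFactor ha).of_le hle).contDiffOn (s := openDisc)
  have hre := (contDiff_re.of_le hle).contDiffOn (s := openDisc)
  have him := (contDiff_im.of_le hle).contDiffOn (s := openDisc)
  have hk := (contDiffOn_const (c := a)).mul ((contDiffOn_const (c := (1 : ℝ))).add hv)
  constructor
  · rw [show (metric a ha).fluxX u = _ from funext (metric_fluxX ha u)]
    exact (hv.mul h1).add ((hk.mul him).mul ((him.mul h1).sub (hre.mul h2)))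
  · rw [show (metric a ha).fluxY u = _ from funext (metric_fluxY ha u)]
    exact (hv.mul h2).add ((hk.mul hre).mul ((hre.mul h2).sub (him.mul h1)))

variable {b : BoundaryCondition} {γ : ℝ} {κ : ℝ} {e e₁ : ℝ → ℝ}

theorem circleCoeff_hasDerivAt (hu : IsEigenfunction (metric a ha) b γ u)
    (he : IsTrigWeight κ e e₁) {r : ℝ} (hr : r ∈ Set.Ioo (0 : ℝ) 1) :
    HasDerivAt (circleCoeff u e)
      ((1 + a * r ^ 2) / r * circleFlux (metric a ha) u e r) r := by
  have hec := he.continuous_fst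
  obtain ⟨h1, h2⟩ := continuousOn_partials_closedDisc hu.contDiff_closed
  have key := hasDerivAt_integral_param (T := 2 * Real.pi) (F := fun r θ => u (polarPt r θ) * e θ)
    (F' := fun r θ => (dX u (polarPt r θ) * Real.cos θ + dY u (polarPt r θ) * Real.sin θ) * e θ)
    (fun r hr => (polar_comp_continuous hu.contDiff_closed.continuousOn
      ⟨hr.1.le, hr.2.le⟩).mul hec) ?_ (fun r hr θ => ?_) hr
  · refine key.congr_deriv ?_
    have hr0 := hr.1.ne'
    have hpos : 1 + a * r ^ 2 ≠ 0 := by positivity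
    rw [circleFlux]
    simp only [radial_flux_polarPt, mul_assoc, intervalIntegral.integral_const_mul]
    field_simp
  · have h1' := polar_comp_continuousOn_Ioo (h1.mono Metric.ball_subset_closedBall)
    have h2' := polar_comp_continuousOn_Ioo (h2.mono Metric.ball_subset_closedBall)
    fun_prop
  · refine (HasPartials.hasDerivAt_radius ?_).mul_const (e θ)
    exact hasPartials_of_differentiableAt (polarPt_mem_openDisc hr θ)
      ((hu.contDiff_interior.differentiableOn (by norm_num)).differentiableAt
        (Metric.isOpen_ball.mem_nhds (polarPt_mem_openDisc hr θ)))

theorem polarPt_two_pi (r : ℝ) : polarPt r (2 * Real.pi) = polarPt r 0 := by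
  simpa using polarPt_add_two_pi r 0

/-- In polar form the equation gives the `r`-derivative of `r` times the radial flux as `-γ r u`
minus the `θ`-derivative of the tangential flux, and the latter flux is `(1 + a r²) / r` times
`∂u/∂θ`. Two integrations by parts over the circle turn this second angular derivative into the
factor `κ`. -/
theorem circleFlux_hasDerivAt (hu : IsEigenfunction (metric a ha) b γ u)
    (he : IsTrigWeight κ e e₁) {r : ℝ} (hr : r ∈ Set.Ioo (0 : ℝ) 1) :
    HasDerivAt (circleFlux (metric a ha) u e)
      ((κ * (1 + a * r ^ 2) / r - γ * r) * circleCoeff u e r) r := by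
  have hec := he.continuous_fst
  have hec₁ := he.continuous_snd
  set X := (metric a ha).fluxX u with hX
  set Y := (metric a ha).fluxY u with hY
  have hrI : r ∈ Set.Icc (0 : ℝ) 1 := ⟨hr.1.le, hr.2.le⟩
  obtain ⟨cX, cY⟩ := continuousOn_flux ha hu.contDiff_closed
  obtain ⟨sX, sY⟩ := contDiffOn_flux ha hu.contDiff_interior
  obtain ⟨cXx, cXy⟩ := continuousOn_partials_openDisc sX
  obtain ⟨cYx, cYy⟩ := continuousOn_partials_openDisc sY
  have pX : ∀ r ∈ Set.Ioo (0 : ℝ) 1, ∀ θ, HasPartials X (dX X (polarPt r θ)) (dY X (polarPt r θ))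
      (polarPt r θ) := fun r hr θ =>
    hasPartials_of_differentiableAt (polarPt_mem_openDisc hr θ)
      ((sX.differentiableOn one_ne_zero).differentiableAt
        (Metric.isOpen_ball.mem_nhds (polarPt_mem_openDisc hr θ)))
  have pY : ∀ r ∈ Set.Ioo (0 : ℝ) 1, ∀ θ, HasPartials Y (dX Y (polarPt r θ)) (dY Y (polarPt r θ))
      (polarPt r θ) := fun r hr θ =>
    hasPartials_of_differentiableAt (polarPt_mem_openDisc hr θ)
      ((sY.differentiableOn one_ne_zero).differentiableAt
        (Metric.isOpen_ball.mem_nhds (polarPt_mem_openDisc hr θ)))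
  have pU : ∀ θ, HasPartials u (dX u (polarPt r θ)) (dY u (polarPt r θ)) (polarPt r θ) := fun θ =>
    hasPartials_of_differentiableAt (polarPt_mem_openDisc hr θ)
      ((hu.contDiff_interior.differentiableOn (by norm_num)).differentiableAt
        (Metric.isOpen_ball.mem_nhds (polarPt_mem_openDisc hr θ)))
  have cU := polar_comp_continuous hu.contDiff_closed.continuousOn hrI
  have cXr := polar_comp_continuous cX hrI
  have cYr := polar_comp_continuous cY hrI
  obtain ⟨cux, cuy⟩ := continuousOn_partials_closedDisc hu.contDiff_closed
  have cuxr := polar_comp_continuous cux hrI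
  have cuyr := polar_comp_continuous cuy hrI
  have hslice : ∀ {f : ℂ → ℝ}, ContinuousOn f openDisc → Continuous fun θ => f (polarPt r θ) :=
    fun hf => (polar_comp_continuousOn_Ioo hf).comp_continuous (f := fun θ => (r, θ))
      (by fun_prop) fun θ => ⟨hr, Set.mem_univ _⟩
  have cXxr := hslice cXx
  have cXyr := hslice cXy
  have cYxr := hslice cYx
  have cYyr := hslice cYy
  set R' := fun r θ => (dX X (polarPt r θ) * Real.cos θ + dY X (polarPt r θ) * Real.sin θ) *
      Real.cos θ + (dX Y (polarPt r θ) * Real.cos θ + dY Y (polarPt r θ) * Real.sin θ) *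
      Real.sin θ with hR'
  have key := hasDerivAt_integral_param (T := 2 * Real.pi)
    (F := fun r θ => (X (polarPt r θ) * Real.cos θ + Y (polarPt r θ) * Real.sin θ) * e θ)
    (F' := fun r θ => R' r θ * e θ)
    (fun r hr => by
      have h1 := polar_comp_continuous cX ⟨hr.1.le, hr.2.le⟩
      have h2 := polar_comp_continuous cY ⟨hr.1.le, hr.2.le⟩
      exact ((h1.mul Real.continuous_cos).add (h2.mul Real.continuous_sin)).mul hec)
    (by
      have h1 := polar_comp_continuousOn_Ioo cXx
      have h2 := polar_comp_continuousOn_Ioo cXy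
      have h3 := polar_comp_continuousOn_Ioo cYx
      have h4 := polar_comp_continuousOn_Ioo cYy
      simp only [hR']
      fun_prop)
    (fun r hr θ => (((pX r hr θ).hasDerivAt_radius.mul_const _).add
      ((pY r hr θ).hasDerivAt_radius.mul_const _)).mul_const (e θ)) hr
  have hq := (hasDerivAt_id r).mul key
  refine hq.congr_deriv ?_
  -- the tangential flux and its derivative along the circle
  set τ := fun θ => -X (polarPt r θ) * Real.sin θ + Y (polarPt r θ) * Real.cos θ with hτ
  set τ' := fun θ => -(dX X (polarPt r θ) * (r * -Real.sin θ) +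
      dY X (polarPt r θ) * (r * Real.cos θ)) * Real.sin θ + -X (polarPt r θ) * Real.cos θ +
      ((dX Y (polarPt r θ) * (r * -Real.sin θ) + dY Y (polarPt r θ) * (r * Real.cos θ)) *
      Real.cos θ + Y (polarPt r θ) * -Real.sin θ) with hτ'
  have dτ : ∀ θ, HasDerivAt τ (τ' θ) θ := fun θ =>
    ((pX r hr θ).hasDerivAt_angle.neg.mul (Real.hasDerivAt_sin θ)).add
      ((pY r hr θ).hasDerivAt_angle.mul (Real.hasDerivAt_cos θ))
  have cτ' : Continuous τ' := by
    have hs := (continuous_const (y := r)).mul Real.continuous_sin.neg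
    have hc := (continuous_const (y := r)).mul Real.continuous_cos
    exact (((((cXxr.mul hs).add (cXyr.mul hc)).neg.mul Real.continuous_sin).add
      (cXr.neg.mul Real.continuous_cos)).add ((((cYxr.mul hs).add (cYyr.mul hc)).mul
      Real.continuous_cos).add (cYr.mul Real.continuous_sin.neg)))
  have parts1 : ∫ θ in (0 : ℝ)..2 * Real.pi, τ' θ * e θ =
      -∫ θ in (0 : ℝ)..2 * Real.pi, τ θ * e₁ θ := by
    have := intervalIntegral.integral_mul_deriv_eq_deriv_mul (a := 0) (b := 2 * Real.pi)
      (fun θ _ => dτ θ) (fun θ _ => he.deriv_fst θ) (cτ'.intervalIntegrable _ _)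
      (hec₁.intervalIntegrable _ _)
    rw [this, he.periodic_fst]
    simp [hτ, polarPt_two_pi]
  have parts2 : ∫ θ in (0 : ℝ)..2 * Real.pi, (dX u (polarPt r θ) * (r * -Real.sin θ) +
      dY u (polarPt r θ) * (r * Real.cos θ)) * e₁ θ = κ * circleCoeff u e r := by
    have := intervalIntegral.integral_mul_deriv_eq_deriv_mul (a := 0) (b := 2 * Real.pi)
      (fun θ _ => (pU θ).hasDerivAt_angle) (fun θ _ => he.deriv_snd θ)
      (Continuous.intervalIntegrable (by fun_prop) _ _)
      (Continuous.intervalIntegrable (by fun_prop) _ _)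
    rw [he.periodic_snd, polarPt_two_pi, sub_self, zero_sub] at this
    have e2 : ∀ θ, u (polarPt r θ) * (-κ * e θ) = -κ * (u (polarPt r θ) * e θ) := fun θ => by ring
    simp only [e2, intervalIntegral.integral_const_mul] at this
    rw [circleCoeff]
    linarith
  have hτe : ∀ θ, τ θ * e₁ θ = (1 + a * r ^ 2) / r * ((dX u (polarPt r θ) * (r * -Real.sin θ) +
      dY u (polarPt r θ) * (r * Real.cos θ)) * e₁ θ) := by
    intro θ
    have hr0 := hr.1.ne'
    simp only [hτ, hX, hY]
    rw [tangential_flux_polarPt]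
    field_simp
  -- The Cartesian divergence rewritten in the rotating frame; the terms in which the frame itself
  -- is differentiated supply the undifferentiated fluxes.
  have hdiv : ∀ θ, (X (polarPt r θ) * Real.cos θ + Y (polarPt r θ) * Real.sin θ) * e θ +
      r * (R' r θ * e θ) = -γ * r * (u (polarPt r θ) * e θ) - τ' θ * e θ := by
    intro θ
    have hl := hu.equation _ (polarPt_mem_openDisc hr θ)
    rw [RiemMetric.laplacian, metric_W, div_one] at hl
    have hc := Real.sin_sq_add_cos_sq θ
    simp only [hR', hτ']
    linear_combination (r * e θ) * hl +
      (r * e θ * (dX X (polarPt r θ) + dY Y (polarPt r θ))) * hc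
  have e3 : (∫ θ in (0 : ℝ)..2 * Real.pi,
      (X (polarPt r θ) * Real.cos θ + Y (polarPt r θ) * Real.sin θ) * e θ) +
      r * ∫ θ in (0 : ℝ)..2 * Real.pi, R' r θ * e θ =
      -γ * r * circleCoeff u e r - ∫ θ in (0 : ℝ)..2 * Real.pi, τ' θ * e θ := by
    rw [circleCoeff, ← intervalIntegral.integral_const_mul, ← intervalIntegral.integral_const_mul,
      ← intervalIntegral.integral_add, ← intervalIntegral.integral_sub]
    · exact intervalIntegral.integral_congr fun θ _ => hdiv θ
    · exact (continuous_const.mul (cU.mul hec)).intervalIntegrable _ _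
    · exact (cτ'.mul hec).intervalIntegrable _ _
    · exact (((cXr.mul Real.continuous_cos).add
        (cYr.mul Real.continuous_sin)).mul hec).intervalIntegrable _ _
    · refine Continuous.intervalIntegrable ?_ _ _
      simp only [hR']
      fun_prop
  rw [parts1] at e3
  simp only [hτe, intervalIntegral.integral_const_mul, parts2] at e3
  simp only [id, one_mul]
  rw [e3]
  ring

theorem solvesSystem_circle (hu : IsEigenfunction (metric a ha) b γ u)
    (he : IsTrigWeight κ e e₁) :
    SolvesSystem (fun r => (1 + a * r ^ 2) / r) (fun r => κ * (1 + a * r ^ 2) / r - γ * r)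
      (circleCoeff u e) (circleFlux (metric a ha) u e) where
  cont_fst := by
    have h1 := polar_comp_continuousOn_Icc hu.contDiff_closed.continuousOn
    have := he.continuous_fst
    exact continuousOn_integral_param (F := fun r θ => u (polarPt r θ) * e θ)
      (h1.mul (this.comp continuous_snd).continuousOn) _
  cont_snd := by
    obtain ⟨cX, cY⟩ := continuousOn_flux ha hu.contDiff_closed
    have h1 := polar_comp_continuousOn_Icc cX
    have h2 := polar_comp_continuousOn_Icc cY
    have := he.continuous_fst
    exact continuousOn_id.mul (continuousOn_integral_param
      (F := fun r θ => ((metric a ha).fluxX u (polarPt r θ) * Real.cos θ +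
        (metric a ha).fluxY u (polarPt r θ) * Real.sin θ) * e θ) (by fun_prop) _)
  deriv_fst r hr := circleCoeff_hasDerivAt ha hu he hr
  deriv_snd r hr := circleFlux_hasDerivAt ha hu he hr
  snd_zero := by simp [circleFlux]

theorem circle_boundary (hu : IsEigenfunction (metric a ha) b γ u) (e : ℝ → ℝ) :
    match b with
    | .neumann => circleFlux (metric a ha) u e 1 = 0
    | .dirichlet => circleCoeff u e 1 = 0 := by
  have hb := hu.boundary
  cases b with
  | neumann =>
    have : ∀ θ, (metric a ha).fluxX u (polarPt 1 θ) * Real.cos θ +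
        (metric a ha).fluxY u (polarPt 1 θ) * Real.sin θ = 0 := fun θ => by
      simpa [RiemMetric.conormalDeriv, polarPt] using hb (polarPt 1 θ) (norm_polarPt zero_le_one θ)
    simp [circleFlux, this]
  | dirichlet =>
    have : ∀ θ, u (polarPt 1 θ) = 0 := fun θ => hb (polarPt 1 θ) (norm_polarPt zero_le_one θ)
    simp [circleCoeff, this]

theorem circle_boundary_mul (hu : IsEigenfunction (metric a ha) b γ u) (e : ℝ → ℝ) :
    circleCoeff u e 1 * circleFlux (metric a ha) u e 1 = 0 := by
  have := circle_boundary ha hu e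
  cases b <;> simp_all

/-- Below the threshold `1 + a` all Fourier coefficients but the zeroth vanish. -/
theorem circleCoeff_eq_zero (hu : IsEigenfunction (metric a ha) b γ u)
    (he : IsTrigWeight κ e e₁) (hκ : 1 ≤ κ) (hγ : γ < 1 + a) {r : ℝ}
    (hr : r ∈ Set.Icc (0 : ℝ) 1) : circleCoeff u e r = 0 := by
  refine (solvesSystem_circle ha hu he).energy (fun r hr => ?_) (fun r hr => ?_)
    (circle_boundary_mul ha hu e) r hr
  · have := hr.1
    positivity
  · have h0 := hr.1
    rw [sub_pos, lt_div_iff₀ h0]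
    -- The threshold comes from `(1 + a) r² ≤ 1 + a r²`, which amounts to `r ≤ 1`.
    have h1 : r * r ≤ 1 := by nlinarith [hr.2]
    have h2 : 0 < r * r := by positivity
    have h3 : γ * (r * r) < (1 + a) * (r * r) := mul_lt_mul_of_pos_right hγ h2
    have h4 : 1 + a * r ^ 2 ≤ κ * (1 + a * r ^ 2) := le_mul_of_one_le_left (by positivity) hκ
    nlinarith

/-- A continuous `2π`-periodic function whose Fourier coefficients of nonzero order vanish is
constant. -/
theorem eq_of_fourier_eq_zero {f : ℝ → ℝ} (hf : Continuous f)
    (hper : Function.Periodic f (2 * Real.pi))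
    (hcos : ∀ n : ℤ, n ≠ 0 → ∫ θ in (0 : ℝ)..2 * Real.pi, f θ * Real.cos (n * θ) = 0)
    (hsin : ∀ n : ℤ, n ≠ 0 → ∫ θ in (0 : ℝ)..2 * Real.pi, f θ * Real.sin (n * θ) = 0) (x y : ℝ) :
    f x = f y := by
  have : Fact (0 < 2 * Real.pi) := ⟨Real.two_pi_pos⟩
  have hperC : Function.Periodic (fun θ => (f θ : ℂ)) (2 * Real.pi) := fun θ => by
    simp only [hper θ]
  have hlift : Continuous hperC.lift := by
    refine continuous_quot_lift _ ?_
    exact Complex.continuous_ofReal.comp hf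
  set F : C(AddCircle (2 * Real.pi), ℂ) := ⟨hperC.lift, hlift⟩ with hF
  have hFx : ∀ θ : ℝ, F (θ : AddCircle (2 * Real.pi)) = f θ := fun θ => rfl
  have hcoef : ∀ n : ℤ, n ≠ 0 → fourierCoeff F n = 0 := by
    intro n hn
    rw [fourierCoeff_eq_intervalIntegral F n 0, zero_add]
    have e1 : ∀ θ : ℝ, fourier (-n) (θ : AddCircle (2 * Real.pi)) • F θ =
        ((f θ * Real.cos (n * θ) : ℝ) : ℂ) - ((f θ * Real.sin (n * θ) : ℝ) : ℂ) * Complex.I := by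
      intro θ
      rw [hFx, fourier_coe_apply, smul_eq_mul]
      have : (2 * Real.pi * Complex.I * ((-n : ℤ) : ℂ) * θ / ((2 * Real.pi : ℝ) : ℂ) : ℂ) =
          ((-(n * θ) : ℝ) : ℂ) * Complex.I := by
        have : (Real.pi : ℂ) ≠ 0 := by exact_mod_cast Real.pi_ne_zero
        push_cast
        field_simp
      rw [this, Complex.exp_mul_I, ← Complex.ofReal_cos, ← Complex.ofReal_sin, Real.cos_neg,
        Real.sin_neg]
      push_cast
      ring
    simp only [e1]
    rw [intervalIntegral.integral_sub, intervalIntegral.integral_mul_const,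
      intervalIntegral.integral_ofReal, intervalIntegral.integral_ofReal, hcos n hn, hsin n hn]
    · simp
    · exact Continuous.intervalIntegrable (by fun_prop) _ _
    · exact Continuous.intervalIntegrable (by fun_prop) _ _
  -- Only the zeroth coefficient survives, so the series is finite and represents the function
  -- pointwise.
  have hsum : Summable (fourierCoeff F) :=
    summable_of_ne_finset_zero (s := {0}) fun n hn => hcoef n (by simpa using hn)
  have hval : ∀ θ : ℝ, (f θ : ℂ) = fourierCoeff F 0 := by
    intro θ
    have h1 := has_pointwise_sum_fourier_series_of_summable hsum (θ : AddCircle (2 * Real.pi))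
    have h2 := hasSum_single
      (f := fun i => fourierCoeff F i • fourier i (θ : AddCircle (2 * Real.pi)))
      0 fun n hn => by simp [hcoef n hn]
    have := h1.unique h2
    simpa [hFx] using this
  exact_mod_cast (hval x).trans (hval y).symm

theorem eigenfunction_polarPt (hu : IsEigenfunction (metric a ha) b γ u) (hγ : γ < 1 + a) {r : ℝ}
    (hr : r ∈ Set.Icc (0 : ℝ) 1) (θ θ' : ℝ) : u (polarPt r θ) = u (polarPt r θ') := by
  have hn : ∀ n : ℤ, n ≠ 0 → (1 : ℝ) ≤ (n : ℝ) ^ 2 := fun n hn => by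
    have : 0 < n ^ 2 := by positivity
    exact_mod_cast this
  exact eq_of_fourier_eq_zero (f := fun θ => u (polarPt r θ))
    (polar_comp_continuous hu.contDiff_closed.continuousOn hr)
    (fun θ => by simp only [polarPt_add_two_pi])
    (fun n h0 => circleCoeff_eq_zero ha hu (isTrigWeight_cos n) (hn n h0) hγ hr)
    (fun n h0 => circleCoeff_eq_zero ha hu (isTrigWeight_sin n) (hn n h0) hγ hr) θ θ'

/-- The flux `2 t φ' / (1 + a t)` equals `-2 l s`. The term `0 * _` is kept so that the system is
literally that of the circle coefficients with `κ = 0`. -/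
theorem solvesSystem_radialSol (l : ℝ) :
    SolvesSystem (fun r => (1 + a * r ^ 2) / r) (fun r => 0 * (1 + a * r ^ 2) / r - 4 * l * r)
      (fun r => radialSol a l (r ^ 2)) (fun r => -2 * l * primSol a l (r ^ 2)) where
  cont_fst := ((continuous_radialSol_right a l).comp (continuous_pow 2)).continuousOn
  cont_snd := (continuous_const.mul
    ((continuous_primSol_right a l).comp (continuous_pow 2))).continuousOn
  deriv_fst r hr := by
    have h := (hasDerivAt_radialSol a l (r ^ 2)).comp r (hasDerivAt_pow 2 r)
    refine h.congr_deriv ?_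
    have := hr.1.ne'
    rw [primSol]
    simp
    field_simp
  deriv_snd r hr := by
    have h := ((hasDerivAt_primSol a l (r ^ 2)).comp r (hasDerivAt_pow 2 r)).const_mul (-2 * l)
    refine h.congr_deriv ?_
    simp
    ring
  snd_zero := by simp [primSol_zero]

/-- Eigenfunctions below the threshold are multiples of the regular radial solution. -/
theorem eigenfunction_classification (hu : IsEigenfunction (metric a ha) b γ u) (hγ : γ < 1 + a) :
    0 ≤ γ ∧ RadialBoundary a b (γ / 4) ∧
      ∃ k : ℝ, k ≠ 0 ∧ ∀ z ∈ closedDisc, u z = k * radialFun a (γ / 4) z := by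
  set l := γ / 4 with hl
  have hγl : γ = 4 * l := by rw [hl]; ring
  have hsys := solvesSystem_circle ha hu isTrigWeight_one
  have hbd := circle_boundary ha hu (fun _ => 1)
  have hc : ∀ r ∈ Set.Icc (0 : ℝ) 1, ∀ θ,
      circleCoeff u (fun _ => 1) r = 2 * Real.pi * u (polarPt r θ) := by
    intro r hr θ
    rw [circleCoeff]
    simp only [fun θ' => eigenfunction_polarPt ha hu hγ hr θ' θ]
    simp
  have hz : ∀ z ∈ closedDisc, ‖z‖ ∈ Set.Icc (0 : ℝ) 1 := fun z hz =>
    ⟨norm_nonneg z, by simpa [closedDisc] using hz⟩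
  have huz : ∀ z ∈ closedDisc, circleCoeff u (fun _ => 1) ‖z‖ = 2 * Real.pi * u z := fun z h => by
    rw [hc ‖z‖ (hz z h) z.arg, polarPt_norm_arg]
  have hpi := Real.pi_pos
  rw [hγl] at hsys
  -- For `l = 0` the flux component vanishes identically, but then the first component is constantly
  -- `1`.
  obtain ⟨k, hk⟩ := hsys.proportional (solvesSystem_radialSol l) fun r hr => by
    rcases radialSol_ne_zero_or a l (sq_nonneg r) with h | h
    · positivity
    · by_cases h0 : l = 0
      · simp [h0, radialSol_param_zero]
      · positivity
  have hk0 : k ≠ 0 := by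
    rintro rfl
    obtain ⟨z, hzd, hne⟩ := hu.ne_zero
    have h1 := (hk ‖z‖ (hz z hzd)).1
    rw [huz z hzd, zero_mul] at h1
    simp [hne, hpi.ne'] at h1
  refine ⟨?_, ?_, k / (2 * Real.pi), by positivity, fun z hzd => ?_⟩
  -- For `γ < 0` the coefficient `-γ r` is positive, and the energy argument kills even the zeroth
  -- coefficient.
  · by_contra! hneg
    have hz0 := hsys.energy (fun r hr => by have := hr.1; positivity)
      (fun r hr => by
        have := hr.1
        rw [zero_mul, zero_div]
        nlinarith) (circle_boundary_mul ha hu _) 0 (by simp)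
    rw [(hk 0 (by simp)).1] at hz0
    simp [radialSol_zero, hk0] at hz0
  · have h1 := hk 1 (by simp)
    cases b with
    | neumann =>
      simp only at hbd
      rw [hbd] at h1
      simpa [hk0, RadialBoundary] using h1.2
    | dirichlet =>
      simp only at hbd
      rw [hbd] at h1
      simpa [hk0, RadialBoundary] using h1.1
  · have h1 := (hk ‖z‖ (hz z hzd)).1
    rw [huz z hzd, ← Complex.normSq_eq_norm_sq] at h1
    rw [radialFun, div_mul_eq_mul_div, ← h1]
    field_simp

end

/-! ### Nodal circles and nodal domains -/

/-- The angle increases strictly from `0`, and `φ` vanishes exactly when it is an odd multiple of `π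
/ 2`; the bounds on the final angle leave room for exactly `n` of these before `t = 1`. -/
theorem exists_zeros_radialSol {a K l : ℝ} (ha : 0 ≤ a) (hK : 0 < K) (hl : 0 ≤ l) {n : ℕ}
    (hlow : ∀ i < n, ((i : ℝ) + 1 / 2) * Real.pi < angle a K l 1)
    (hup : angle a K l 1 ≤ ((n : ℝ) + 1 / 2) * Real.pi) :
    ∃ τ : Fin n → ℝ, StrictMono τ ∧ (∀ i, τ i ∈ Set.Ioo (0 : ℝ) 1) ∧
      ∀ t ∈ Set.Ico (0 : ℝ) 1, radialSol a l t = 0 ↔ ∃ i, t = τ i := by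
  have hπ := Real.pi_pos
  have hmono := strictMonoOn_angle ha hK hl
  have hex : ∀ i : Fin n, ∃ t ∈ Set.Ioo (0 : ℝ) 1, angle a K l t = ((i : ℝ) + 1 / 2) * Real.pi := by
    intro i
    exact intermediate_value_Ioo zero_le_one (continuous_angle_right hK l).continuousOn
      ⟨by rw [angle_zero]; positivity, hlow i i.2⟩
  choose τ hτ hτe using hex
  refine ⟨τ, fun i j hij => ?_, hτ, fun t ht => ⟨fun h => ?_, ?_⟩⟩
  · rw [← hmono.lt_iff_lt (Set.mem_Ici.2 (hτ i).1.le) (Set.mem_Ici.2 (hτ j).1.le), hτe, hτe]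
    have : (i : ℝ) < (j : ℝ) := by exact_mod_cast hij
    gcongr
  · rw [radialSol_eq_zero_iff hK l ht.1, Real.cos_eq_zero_iff] at h
    obtain ⟨k, hk⟩ := h
    have h0 : 0 ≤ angle a K l t := by
      rw [← angle_zero (a := a) (K := K) l]
      exact hmono.monotoneOn (Set.mem_Ici.2 le_rfl) ht.1 ht.1
    -- Strict because `t < 1`: the Dirichlet zero at the boundary, where `hup` is an equality, is
    -- not counted.
    have h1 : angle a K l t < angle a K l 1 := hmono ht.1 (Set.mem_Ici.2 zero_le_one) ht.2
    rw [hk] at h0 h1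
    have hk0 : (-1 : ℝ) < k := by
      by_contra! hneg
      nlinarith
    have hkn : (k : ℝ) < n := by
      by_contra! hneg
      nlinarith
    have hk0' : (0 : ℤ) ≤ k := by
      have : (-1 : ℤ) < k := by exact_mod_cast hk0
      omega
    obtain ⟨i, rfl⟩ := Int.eq_ofNat_of_zero_le hk0'
    have hin : i < n := by exact_mod_cast hkn
    refine ⟨⟨i, hin⟩, hmono.injOn ht.1 (hτ _).1.le ?_⟩
    rw [hτe, hk]
    push_cast
    ring
  · rintro ⟨i, rfl⟩
    rw [radialSol_eq_zero_iff hK l (hτ i).1.le, hτe, Real.cos_eq_zero_iff]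
    exact ⟨i, by push_cast; ring⟩

/-- The number of radii below `r`. -/
noncomputable def numBelow {n : ℕ} (ρ : Fin n → ℝ) (r : ℝ) : ℕ :=
  (Finset.univ.filter fun i => ρ i < r).card

theorem numBelow_lt {n : ℕ} (ρ : Fin n → ℝ) (r : ℝ) : numBelow ρ r < n + 1 :=
  Nat.lt_succ_of_le ((Finset.card_le_univ _).trans (by simp))

theorem ordConnected_numBelow {n : ℕ} (ρ : Fin n → ℝ) (k : ℕ) :
    {r : ℝ | r ∈ Set.Ico (0 : ℝ) 1 ∧ (∀ i, r ≠ ρ i) ∧ numBelow ρ r = k}.OrdConnected := by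
  refine ⟨fun x hx y hy r hr => ?_⟩
  have hsub1 : (Finset.univ.filter fun i => ρ i < x) ⊆ Finset.univ.filter fun i => ρ i < r :=
    fun i hi => by
      simp only [Finset.mem_filter, Finset.mem_univ, true_and] at *
      exact hi.trans_le hr.1
  have hsub2 : (Finset.univ.filter fun i => ρ i < r) ⊆ Finset.univ.filter fun i => ρ i < y :=
    fun i hi => by
      simp only [Finset.mem_filter, Finset.mem_univ, true_and] at *
      exact hi.trans_le hr.2
  have hxy := Finset.eq_of_subset_of_card_le (hsub1.trans hsub2)
    (le_of_eq (hy.2.2.trans hx.2.2.symm))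
  refine ⟨⟨hx.1.1.trans hr.1, hr.2.trans_lt hy.1.2⟩, fun i hi => ?_, ?_⟩
  · subst hi
    have h1 : ρ i < y := lt_of_le_of_ne hr.2 (Ne.symm (hy.2.1 i))
    have h2 : i ∈ Finset.univ.filter fun i => ρ i < y := by simpa using h1
    rw [← hxy] at h2
    simp only [Finset.mem_filter, Finset.mem_univ, true_and] at h2
    exact not_le.2 h2 hr.1
  · rw [← hx.2.2]
    exact congrArg Finset.card (Finset.Subset.antisymm (hxy ▸ hsub2) hsub1)

theorem exists_numBelow_eq {n : ℕ} {ρ : Fin n → ℝ} (hρ : StrictMono ρ)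
    (h01 : ∀ i, ρ i ∈ Set.Ioo (0 : ℝ) 1) {k : ℕ} (hk : k ≤ n) :
    ∃ r ∈ Set.Ico (0 : ℝ) 1, (∀ i, r ≠ ρ i) ∧ numBelow ρ r = k := by
  -- The witness is the midpoint of the `k`-th gap in the list `0`, radii, `1`; `lo` and `hi` are
  -- the ends of this gap.
  obtain ⟨lo, hlo0, hlo1, hlo, hlo'⟩ : ∃ lo : ℝ, 0 ≤ lo ∧ lo < 1 ∧
      (∀ i : Fin n, i.1 < k → ρ i ≤ lo) ∧
      ∀ i : Fin n, k ≤ i.1 → lo < ρ i := by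
    rcases k with _ | k
    · exact ⟨0, le_rfl, one_pos, fun i hi => absurd hi (Nat.not_lt_zero _), fun i _ => (h01 i).1⟩
    · refine ⟨ρ ⟨k, hk⟩, (h01 _).1.le, (h01 _).2, fun i hi => hρ.monotone ?_, fun i hi => hρ ?_⟩
      · exact Fin.le_def.2 (Nat.lt_succ_iff.1 hi)
      · exact Fin.lt_def.2 hi
  obtain ⟨hi, hhi1, hlohi, hhi⟩ : ∃ hi : ℝ, hi ≤ 1 ∧ lo < hi ∧ ∀ i : Fin n, k ≤ i.1 → hi ≤ ρ i := by
    rcases hk.lt_or_eq with h | h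
    · exact ⟨ρ ⟨k, h⟩, (h01 _).2.le, hlo' _ le_rfl, fun i hi => hρ.monotone (Fin.le_def.2 hi)⟩
    · exact ⟨1, le_rfl, hlo1, fun i hi => absurd i.2 (not_lt.2 (h ▸ hi))⟩
  have hiff : ∀ i : Fin n, ρ i < (lo + hi) / 2 ↔ i.1 < k := fun i => by
    constructor
    · intro h
      by_contra! hki
      linarith [hhi i hki]
    · intro h
      linarith [hlo i h]
  refine ⟨(lo + hi) / 2, ⟨by linarith, by linarith⟩, fun i he => ?_, ?_⟩
  · rcases lt_or_ge i.1 k with h | h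
    · linarith [hlo i h]
    · linarith [hhi i h]
  · simp only [numBelow, hiff]
    rw [Fin.card_filter_val_lt, min_eq_right hk]

/-- The number of radii below `‖z‖` is locally constant and takes each of the `n + 1` values. Its
fibres are connected, being images of an interval of radii times all angles, so it separates the
components. -/
theorem card_connectedComponents_disc_diff_circles {n : ℕ} {ρ : Fin n → ℝ} (hρ : StrictMono ρ)
    (h01 : ∀ i, ρ i ∈ Set.Ioo (0 : ℝ) 1) :
    Nat.card (ConnectedComponents ↥(openDisc \ ⋃ i, Metric.sphere (0 : ℂ) (ρ i))) = n + 1 := by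
  set X := openDisc \ ⋃ i, Metric.sphere (0 : ℂ) (ρ i) with hX
  have hmem : ∀ z : ℂ, z ∈ X ↔ ‖z‖ ∈ Set.Ico (0 : ℝ) 1 ∧ ∀ i, ‖z‖ ≠ ρ i := fun z => by
    simp [hX, openDisc]
  set N : X → Fin (n + 1) := fun z => ⟨numBelow ρ ‖(z : ℂ)‖, numBelow_lt ρ _⟩ with hN
  have hNc : Continuous N := by
    refine IsLocallyConstant.continuous (IsLocallyConstant.iff_eventually_eq N |>.2 fun z => ?_)
    have hne := ((hmem z).1 z.2).2
    have hc : ContinuousAt (fun w : X => ‖(w : ℂ)‖) z := by fun_prop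
    have hev : ∀ᶠ w : X in nhds z, ∀ i, (ρ i < ‖(w : ℂ)‖ ↔ ρ i < ‖(z : ℂ)‖) := by
      rw [Filter.eventually_all]
      intro i
      rcases lt_or_gt_of_ne (hne i) with h | h
      · filter_upwards [hc.eventually_lt_const h] with w hw
        exact ⟨fun h' => absurd h' (not_lt.2 hw.le), fun h' => absurd h' (not_lt.2 h.le)⟩
      · filter_upwards [hc.eventually_const_lt h] with w hw
        exact ⟨fun _ => h, fun _ => hw⟩
    filter_upwards [hev] with w hw
    simp only [hN, numBelow, hw]
  have hfib : ∀ k : Fin (n + 1), IsPreconnected (N ⁻¹' {k}) := by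
    intro k
    rw [← Topology.IsInducing.subtypeVal.isPreconnected_image]
    have himg : Subtype.val '' (N ⁻¹' {k}) = (fun q : ℝ × ℝ => polarPt q.1 q.2) ''
        ({r : ℝ | r ∈ Set.Ico (0 : ℝ) 1 ∧ (∀ i, r ≠ ρ i) ∧ numBelow ρ r = k} ×ˢ Set.univ) := by
      ext z
      constructor
      · rintro ⟨w, hw, rfl⟩
        have h1 := (hmem w).1 w.2
        have h2 : numBelow ρ ‖(w : ℂ)‖ = k := congrArg Fin.val hw
        exact ⟨(‖(w : ℂ)‖, (w : ℂ).arg), ⟨⟨h1.1, h1.2, h2⟩, Set.mem_univ _⟩, polarPt_norm_arg _⟩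
      · rintro ⟨⟨r, θ⟩, ⟨⟨hr, hne, hk⟩, -⟩, rfl⟩
        have hnorm := norm_polarPt hr.1 θ
        refine ⟨⟨polarPt r θ, (hmem _).2 ?_⟩, ?_, rfl⟩
        · rw [hnorm]
          exact ⟨hr, hne⟩
        · simp [hN, hnorm, hk]
    rw [himg]
    exact ((ordConnected_numBelow ρ k).isPreconnected.prod isPreconnected_univ).image _
      continuous_polarPt.continuousOn
  have hsurj : Function.Surjective N := by
    intro k
    obtain ⟨r, hr, hne, hk⟩ := exists_numBelow_eq hρ h01 (Nat.lt_succ_iff.1 k.2)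
    have hnorm := norm_polarPt hr.1 0
    refine ⟨⟨polarPt r 0, (hmem _).2 (by rw [hnorm]; exact ⟨hr, hne⟩)⟩, ?_⟩
    simp [hN, hnorm, hk]
  have hbij : Function.Bijective hNc.connectedComponentsLift := by
    constructor
    · intro x y hxy
      obtain ⟨x, rfl⟩ := ConnectedComponents.surjective_coe x
      obtain ⟨y, rfl⟩ := ConnectedComponents.surjective_coe y
      simp only [Continuous.connectedComponentsLift_apply_coe] at hxy
      rw [ConnectedComponents.coe_eq_coe']
      exact (hfib (N y)).subset_connectedComponent rfl hxy
    · intro k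
      obtain ⟨z, hz⟩ := hsurj k
      exact ⟨z, by simpa using hz⟩
  rw [Nat.card_congr (Equiv.ofBijective _ hbij), Nat.card_eq_fintype_card, Fintype.card_fin]

/-- The nodal structure of a multiple of a radial function with known zeros. -/
theorem nodal_structure {a l k : ℝ} {u : ℂ → ℝ} (hk : k ≠ 0)
    (hu : ∀ z ∈ closedDisc, u z = k * radialFun a l z) {n : ℕ} {τ : Fin n → ℝ}
    (hτ : StrictMono τ) (hτ01 : ∀ i, τ i ∈ Set.Ioo (0 : ℝ) 1)
    (hzero : ∀ t ∈ Set.Ico (0 : ℝ) 1, radialSol a l t = 0 ↔ ∃ i, t = τ i) :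
    (∃ ρ : Fin n → ℝ, StrictMono ρ ∧ (∀ i, ρ i ∈ Set.Ioo (0 : ℝ) 1) ∧
      nodalSet u = ⋃ i, Metric.sphere (0 : ℂ) (ρ i)) ∧ Nat.card (NodalDomains u) = n + 1 := by
  set ρ : Fin n → ℝ := fun i => √(τ i) with hρdef
  have hρ : StrictMono ρ := fun i j hij => Real.sqrt_lt_sqrt (hτ01 i).1.le (hτ hij)
  have hρ01 : ∀ i, ρ i ∈ Set.Ioo (0 : ℝ) 1 := fun i =>
    ⟨Real.sqrt_pos.2 (hτ01 i).1, by
      rw [hρdef]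
      simpa using Real.sqrt_lt_sqrt (hτ01 i).1.le (hτ01 i).2⟩
  have hnod : nodalSet u = ⋃ i, Metric.sphere (0 : ℂ) (ρ i) := by
    have hset : {z ∈ openDisc | u z = 0} = ⋃ i, Metric.sphere (0 : ℂ) (ρ i) := by
      ext z
      simp only [Set.mem_ofPred_eq, Set.mem_iUnion, mem_sphere_zero_iff_norm, Metric.mem_ball,
        dist_zero_right]
      have hiff : ∀ i, ‖z‖ = ρ i ↔ ‖z‖ ^ 2 = τ i := fun i => by
        rw [hρdef, eq_comm, Real.sqrt_eq_iff_eq_sq (hτ01 i).1.le (norm_nonneg _), eq_comm]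
      have huz : ‖z‖ < 1 → (u z = 0 ↔ ∃ i, ‖z‖ ^ 2 = τ i) := fun h => by
        rw [hu z (by simpa [closedDisc] using h.le), mul_eq_zero, or_iff_right hk, radialFun,
          Complex.normSq_eq_norm_sq]
        exact hzero _ ⟨by positivity, by nlinarith [norm_nonneg z]⟩
      constructor
      · rintro ⟨h1, h2⟩
        obtain ⟨i, hi⟩ := (huz h1).1 h2
        exact ⟨i, (hiff i).2 hi⟩
      · rintro ⟨i, hi⟩
        have h1 : ‖z‖ < 1 := hi ▸ (hρ01 i).2
        exact ⟨h1, (huz h1).2 ⟨i, (hiff i).1 hi⟩⟩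
    rw [nodalSet, hset]
    exact (isClosed_iUnion_of_finite fun i => Metric.isClosed_sphere).closure_eq
  refine ⟨⟨ρ, hρ, hρ01, hnod⟩, ?_⟩
  unfold NodalDomains
  rw [hnod]
  exact card_connectedComponents_disc_diff_circles hρ hρ01

/-! ### The radial spectrum -/

theorem radialBoundary_neumann_iff {a K l : ℝ} (hK : 0 < K) :
    RadialBoundary a .neumann l ↔ l = 0 ∨ Real.sin (angle a K l 1) = 0 := by
  rw [RadialBoundary, primSol_eq_zero_iff hK l zero_le_one]

theorem radialBoundary_dirichlet_iff {a K l : ℝ} (hK : 0 < K) :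
    RadialBoundary a .dirichlet l ↔ Real.cos (angle a K l 1) = 0 := by
  rw [RadialBoundary, radialSol_eq_zero_iff hK l zero_le_one]

theorem angle_one_pos {a K l : ℝ} (ha : 0 ≤ a) (hK : 0 < K) (hl : 0 ≤ l) : 0 < angle a K l 1 := by
  simpa [angle_zero] using strictMonoOn_angle ha hK hl Set.self_mem_Ici
    (Set.mem_Ici.2 zero_le_one) one_pos

/-- The boundary condition prescribes the final Prüfer angle. -/
theorem exists_levels {a K : ℝ} (ha : 0 ≤ a) (hK : 0 < K) (b : BoundaryCondition) :
    ∃ y : ℕ → ℝ, StrictMono y ∧ angle a K 0 1 ≤ y 0 ∧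
      (∀ i, y i ≤ ((i : ℝ) + 1 / 2) * Real.pi) ∧
      (∀ i k : ℕ, k < i → ((k : ℝ) + 1 / 2) * Real.pi < y i) ∧
      ∀ l, 0 ≤ l → (RadialBoundary a b l ↔ ∃ i, angle a K l 1 = y i) := by
  have hπ := Real.pi_pos
  have h0 := angle_param_zero_lt (a := a) hK
  cases b with
  | neumann =>
    -- Level `0` belongs to the constants. Their final angle lies below `π / 2` and is not a
    -- multiple of `π`, so it is prescribed separately.
    set y : ℕ → ℝ := fun i => if i = 0 then angle a K 0 1 else i * Real.pi with hy
    have hy0 : y 0 = angle a K 0 1 := by simp [hy]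
    have hys : ∀ i, y (i + 1) = ((i : ℝ) + 1) * Real.pi := fun i => by simp [hy]
    refine ⟨y, strictMono_nat_of_lt_succ fun i => ?_, hy0.ge, fun i => ?_, fun i k hki => ?_,
      fun l hl => ?_⟩
    · rcases i with _ | i
      · rw [hy0, hys]
        push_cast
        linarith
      · rw [hys, hys]
        push_cast
        nlinarith
    · rcases i with _ | i
      · rw [hy0]
        push_cast
        linarith
      · rw [hys]
        push_cast
        nlinarith
    · rcases i with _ | i
      · omega
      · have : (k : ℝ) ≤ i := by exact_mod_cast Nat.lt_succ_iff.1 hki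
        rw [hys]
        nlinarith
    · rw [radialBoundary_neumann_iff hK]
      constructor
      · rintro (rfl | h)
        · exact ⟨0, hy0.symm⟩
        · obtain ⟨n, hn⟩ := Real.sin_eq_zero_iff.1 h
          have hp := angle_one_pos ha hK hl
          have hn0 : 0 < n := by
            by_contra! hneg
            have : (n : ℝ) ≤ 0 := by exact_mod_cast hneg
            nlinarith
          obtain ⟨i, rfl⟩ := Int.eq_succ_of_zero_lt hn0
          refine ⟨i + 1, ?_⟩
          rw [hys, ← hn]
          push_cast
          ring
      · rintro ⟨i, hi⟩
        rcases i with _ | i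
        · left
          by_contra hne
          have := angle_one_lt (a := a) ha hK le_rfl (lt_of_le_of_ne hl (Ne.symm hne))
          rw [hi, hy0] at this
          exact lt_irrefl _ this
        · right
          rw [hi, hys]
          exact_mod_cast Real.sin_nat_mul_pi (i + 1)
  | dirichlet =>
    refine ⟨fun i => ((i : ℝ) + 1 / 2) * Real.pi, strictMono_nat_of_lt_succ fun i => ?_, ?_,
      fun i => le_rfl, fun i k hki => ?_, fun l hl => ?_⟩
    · push_cast
      nlinarith
    · push_cast
      linarith
    · have : (k : ℝ) < i := by exact_mod_cast hki
      nlinarith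
    · rw [radialBoundary_dirichlet_iff hK, Real.cos_eq_zero_iff]
      constructor
      · rintro ⟨n, hn⟩
        have hp := angle_one_pos ha hK hl
        have hn0 : (0 : ℤ) ≤ n := by
          by_contra! hneg
          have : (n : ℝ) ≤ -1 := by exact_mod_cast Int.le_sub_one_of_lt hneg
          nlinarith
        obtain ⟨i, rfl⟩ := Int.eq_ofNat_of_zero_le hn0
        refine ⟨i, ?_⟩
        rw [hn]
        push_cast
        ring
      · rintro ⟨i, hi⟩
        refine ⟨i, ?_⟩
        rw [hi]
        push_cast
        ring

/-- The first `M` radial eigenvalue parameters, with the number of zeros of the solutions. -/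
theorem exists_radial_spectrum {a : ℝ} (ha : 0 < a) {M : ℕ} (hM : 0 < M) (b : BoundaryCondition) :
    ∃ lam : ℕ → ℝ, (∀ i < M, 0 ≤ lam i ∧ lam i ≤ (M * Real.pi) ^ 2 / a ∧
        RadialBoundary a b (lam i) ∧ angle a (M * Real.pi) (lam i) 1 ≤ ((i : ℝ) + 1 / 2) * Real.pi ∧
        ∀ k < i, ((k : ℝ) + 1 / 2) * Real.pi < angle a (M * Real.pi) (lam i) 1) ∧
      (∀ i j, i < j → j < M → lam i < lam j) ∧
      ∀ j < M, ∀ l, 0 ≤ l → RadialBoundary a b l → l ≤ lam j → ∃ i ≤ j, l = lam i := by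
  have hπ := Real.pi_pos
  set K : ℝ := M * Real.pi with hKdef
  have hK : 0 < K := by positivity
  obtain ⟨y, hmono, hy0, hyu, hyl, hiff⟩ := exists_levels ha.le hK b
  have hlt : ∀ l μ, 0 ≤ l → l < μ → angle a K l 1 < angle a K μ 1 := fun l μ h h' =>
    angle_one_lt ha.le hK h h'
  -- With `K = M π` the first `M` levels lie below `K`, hence are attained for some `l ≤ K² / a` by
  -- the intermediate value theorem.
  have hyK : ∀ i < M, y i ≤ K := fun i hi => by
    refine (hyu i).trans ?_
    have : (i : ℝ) + 1 ≤ M := by exact_mod_cast hi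
    rw [hKdef]
    nlinarith
  have hex : ∀ i, ∃ l, i < M → l ∈ Set.Icc (0 : ℝ) (K ^ 2 / a) ∧ angle a K l 1 = y i := by
    intro i
    by_cases hi : i < M
    · obtain ⟨l, hl, hle⟩ := intermediate_value_Icc (by positivity : (0 : ℝ) ≤ K ^ 2 / a)
        (continuous_angle_left (a := a) hK 1).continuousOn
        ⟨hy0.trans (hmono.monotone (Nat.zero_le i)), (hyK i hi).trans (le_angle_one ha hK)⟩
      exact ⟨l, fun _ => ⟨hl, hle⟩⟩
    · exact ⟨0, fun h => absurd h hi⟩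
  choose lam hlam using hex
  refine ⟨lam, fun i hi => ?_, fun i j hij hj => ?_, fun j hj l hl hb hlj => ?_⟩
  · obtain ⟨hI, he⟩ := hlam i hi
    refine ⟨hI.1, hI.2, (hiff _ hI.1).2 ⟨i, he⟩, he ▸ hyu i, fun k hk => he ▸ hyl i k hk⟩
  · obtain ⟨hI, he⟩ := hlam i (hij.trans hj)
    obtain ⟨hJ, he'⟩ := hlam j hj
    by_contra! hle
    have h1 := hmono hij
    rw [← he, ← he'] at h1
    rcases hle.eq_or_lt with h | h
    · rw [h] at h1
      exact lt_irrefl _ h1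
    · exact lt_asymm h1 (hlt _ _ hJ.1 h)
  · obtain ⟨i, hi⟩ := (hiff l hl).1 hb
    obtain ⟨hJ, he'⟩ := hlam j hj
    have hij : i ≤ j := by
      rw [← hmono.le_iff_le, ← hi, ← he']
      rcases hlj.eq_or_lt with h | h
      · rw [h]
      · exact (hlt _ _ hl h).le
    obtain ⟨hI, he⟩ := hlam i (hij.trans_lt hj)
    refine ⟨i, hij, ?_⟩
    rcases lt_trichotomy l (lam i) with h | h | h
    · have := hlt _ _ hl h
      rw [hi, he] at this
      exact absurd this (lt_irrefl _)
    · exact h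
    · have := hlt _ _ hI.1 h
      rw [hi, he] at this
      exact absurd this (lt_irrefl _)

/-! ### Linear independence and the dimension of spectral subspaces -/

/-- Lagrange's identity: the integrand times `l - μ` is the derivative of `l s_l φ_μ - μ s_μ φ_l`,
which vanishes at both ends. No weight appears, as the area density is one. -/
theorem integral_radialSol_mul {a l μ : ℝ} (hlμ : l ≠ μ) {b : BoundaryCondition}
    (hl : RadialBoundary a b l) (hμ : RadialBoundary a b μ) :
    ∫ t in (0 : ℝ)..1, radialSol a l t * radialSol a μ t = 0 := by
  have hd : ∀ t ∈ Set.uIcc (0 : ℝ) 1, HasDerivAt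
      (fun t => l * primSol a l t * radialSol a μ t - μ * primSol a μ t * radialSol a l t)
      ((l - μ) * (radialSol a l t * radialSol a μ t)) t := fun t _ => by
    have h1 := ((hasDerivAt_primSol a l t).const_mul l).mul (hasDerivAt_radialSol a μ t)
    have h2 := ((hasDerivAt_primSol a μ t).const_mul μ).mul (hasDerivAt_radialSol a l t)
    refine (h1.sub h2).congr_deriv ?_
    simp only [primSol]
    ring
  have hc1 := continuous_radialSol_right a l
  have hc2 := continuous_radialSol_right a μ
  have h := intervalIntegral.integral_eq_sub_of_hasDerivAt hd
    (Continuous.intervalIntegrable (by fun_prop) _ _)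
  rw [intervalIntegral.integral_const_mul, primSol_zero, primSol_zero] at h
  have hz : l * primSol a l 1 * radialSol a μ 1 - μ * primSol a μ 1 * radialSol a l 1 = 0 := by
    cases b with
    | neumann =>
      have e1 : l * primSol a l 1 = 0 := by rcases hl with h | h <;> simp [h]
      have e2 : μ * primSol a μ 1 = 0 := by rcases hμ with h | h <;> simp [h]
      rw [e1, e2]
      ring
    | dirichlet =>
      have e1 : radialSol a l 1 = 0 := hl
      have e2 : radialSol a μ 1 = 0 := hμ
      rw [e1, e2]
      ring
  rw [hz] at h
  simpa [sub_ne_zero.2 hlμ] using h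

theorem integral_radialSol_sq_pos (a l : ℝ) :
    0 < ∫ t in (0 : ℝ)..1, radialSol a l t * radialSol a l t := by
  have hc := continuous_radialSol_right a l
  refine intervalIntegral.integral_pos one_pos (by fun_prop) (fun t _ => mul_self_nonneg _)
    ⟨0, by simp, by simp [radialSol_zero]⟩

theorem linearIndependent_radialFun {a : ℝ} {b : BoundaryCondition} {n : ℕ} {lam : Fin n → ℝ}
    (hinj : Function.Injective lam) (hb : ∀ i, RadialBoundary a b (lam i)) :
    LinearIndependent ℝ fun i => closedDisc.domRestrict (radialFun a (lam i)) := by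
  rw [Fintype.linearIndependent_iff]
  intro c hc j
  have hpt : ∀ t ∈ Set.Icc (0 : ℝ) 1, ∑ i, c i * radialSol a (lam i) t = 0 := by
    intro t ht
    -- The radial function takes the profile's value at `t` at the point `√t`.
    have hmem : ((√t : ℝ) : ℂ) ∈ closedDisc := by
      simpa [closedDisc, abs_of_nonneg (Real.sqrt_nonneg t)] using ht.2
    have := congrFun hc ⟨_, hmem⟩
    simpa [radialFun, Real.mul_self_sqrt ht.1] using this
  have hint :
      ∫ t in (0 : ℝ)..1, (∑ i, c i * radialSol a (lam i) t) * radialSol a (lam j) t = 0 := by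
    rw [intervalIntegral.integral_congr (g := fun _ => 0)]
    · simp
    · intro t ht
      rw [Set.uIcc_of_le zero_le_one] at ht
      simp [hpt t ht]
  simp only [Finset.sum_mul] at hint
  have hcont := fun l => continuous_radialSol_right a l
  rw [intervalIntegral.integral_finsetSum fun i _ =>
    Continuous.intervalIntegrable (by fun_prop) _ _, Finset.sum_eq_single j] at hint
  · simp only [mul_assoc, intervalIntegral.integral_const_mul] at hint
    exact (mul_eq_zero.1 hint).resolve_right (integral_radialSol_sq_pos a _).ne'
  · intro i _ hij
    simp only [mul_assoc, intervalIntegral.integral_const_mul]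
    rw [integral_radialSol_mul (hinj.ne hij) (hb i) (hb j), mul_zero]
  · simp

/-- Reduces counting eigenvalues with multiplicity to counting radial parameters: below `1 + a` the
classification leaves only multiples of the orthogonal radial solutions. -/
theorem rank_eigenSpan {a : ℝ} (ha : 0 ≤ a) {b : BoundaryCondition} {S : Set ℝ}
    (hS : ∀ γ ∈ S, γ < 1 + a) {n : ℕ} {lam : Fin n → ℝ} (hinj : Function.Injective lam)
    (hb : ∀ i, RadialBoundary a b (lam i)) (hmem : ∀ i, 4 * lam i ∈ S)
    (hall : ∀ l, 0 ≤ l → RadialBoundary a b l → 4 * l ∈ S → ∃ i, l = lam i) :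
    Module.rank ℝ (eigenSpan (metric a ha) b S) = n := by
  have hspan : eigenSpan (metric a ha) b S =
      Submodule.span ℝ (Set.range fun i => closedDisc.domRestrict (radialFun a (lam i))) := by
    refine le_antisymm (Submodule.span_le.2 ?_) (Submodule.span_mono ?_)
    · rintro v ⟨γ, hγ, u, hu, rfl⟩
      obtain ⟨h0, hbd, k, -, hk⟩ := eigenfunction_classification ha hu (hS γ hγ)
      have e : 4 * (γ / 4) = γ := by ring
      obtain ⟨i, hi⟩ := hall (γ / 4) (by positivity) hbd (e.symm ▸ hγ)
      have : closedDisc.domRestrict u = k • closedDisc.domRestrict (radialFun a (lam i)) := by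
        ext z
        simp [hk z z.2, hi]
      rw [this]
      exact Submodule.smul_mem _ _ (Submodule.subset_span ⟨i, rfl⟩)
    · rintro v ⟨i, rfl⟩
      exact ⟨4 * lam i, hmem i, _, isEigenfunction_radialFun ha _ (hb i), rfl⟩
  have hli := linearIndependent_radialFun hinj hb
  rw [hspan, rank_span hli, Cardinal.mk_range_eq _ hli.injective, Cardinal.mk_fin]

/-! ### Conclusion -/

theorem isRadial_of_eq {a l k : ℝ} {u : ℂ → ℝ}
    (hu : ∀ z ∈ closedDisc, u z = k * radialFun a l z) : IsRadial u := by
  intro w z hz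
  have hwz : (w : ℂ) * z ∈ closedDisc := by
    rw [mem_closedBall_zero_iff, norm_mul, Circle.norm_coe, one_mul]
    exact mem_closedBall_zero_iff.1 hz
  rw [hu _ hwz, hu z hz, radialFun, radialFun]
  simp [Complex.normSq_mul]

/-- Here the two scales meet: `4 l ≤ 4 K² / a < a`, since `(2 K)² < a²`. -/
theorem four_mul_lt {a K l : ℝ} (hK : 0 < K) (ha : 2 * K < a) (hl : l ≤ K ^ 2 / a) :
    4 * l < 1 + a := by
  have ha0 : 0 < a := by linarith
  rw [le_div_iff₀ ha0] at hl
  by_contra! h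
  nlinarith

/-- For a large parameter the first `M` eigenvalues of the metric are simple, with radial
eigenfunctions having the expected nodal circles. -/
theorem spectral_structure {a : ℝ} {M : ℕ} (hM : 0 < M) (ha : 2 * (M * Real.pi) < a)
    (ha0 : 0 ≤ a) (b : BoundaryCondition) :
    ∃ lam : ℕ → ℝ, ∀ i < M, 0 ≤ lam i ∧ RadialBoundary a b (lam i) ∧
      angle a (M * Real.pi) (lam i) 1 ≤ ((i : ℝ) + 1 / 2) * Real.pi ∧
      (∀ k < i, ((k : ℝ) + 1 / 2) * Real.pi < angle a (M * Real.pi) (lam i) 1) ∧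
      4 * lam i < 1 + a ∧ IsNthEigenvalue (metric a ha0) b (i + 1) (4 * lam i) ∧
      IsSimpleEigenvalue (metric a ha0) b (4 * lam i) := by
  have hK : 0 < M * Real.pi := by have := Real.pi_pos; positivity
  have hapos : 0 < a := by linarith
  obtain ⟨lam, h1, hmono, hall⟩ := exists_radial_spectrum hapos hM b
  refine ⟨lam, fun i hi => ?_⟩
  obtain ⟨hl0, hlK, hb, hup, hlow⟩ := h1 i hi
  have hthr := four_mul_lt hK ha hlK
  have hinj : ∀ n ≤ M, Function.Injective fun k : Fin n => lam k := fun n hn k k' h => by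
    by_contra hne
    rcases lt_or_gt_of_ne (fun h' => hne (Fin.ext h') : k.1 ≠ k'.1) with hlt | hlt
    · exact (hmono _ _ hlt (k'.2.trans_le hn)).ne h
    · exact (hmono _ _ hlt (k.2.trans_le hn)).ne' h
  have rlt : Module.rank ℝ (eigenSpan (metric a ha0) b (Set.Iio (4 * lam i))) = i := by
    refine rank_eigenSpan ha0 (S := Set.Iio (4 * lam i)) (fun γ hγ => lt_trans hγ hthr)
      (hinj i hi.le)
      (fun k => (h1 k (k.2.trans hi)).2.2.1) (fun k => ?_) fun l hl hbl hlt => ?_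
    · have := hmono k i k.2 hi
      rw [Set.mem_Iio]
      linarith
    · rw [Set.mem_Iio] at hlt
      obtain ⟨k, hk, rfl⟩ := hall i hi l hl hbl (by linarith)
      exact ⟨⟨k, lt_of_le_of_ne hk fun h => by subst h; exact lt_irrefl _ hlt⟩, rfl⟩
  have rle : Module.rank ℝ (eigenSpan (metric a ha0) b (Set.Iic (4 * lam i))) = (i + 1 : ℕ) := by
    refine rank_eigenSpan ha0 (S := Set.Iic (4 * lam i))
      (fun γ hγ => lt_of_le_of_lt hγ hthr) (hinj (i + 1) hi)
      (fun k => (h1 k (k.2.trans_le hi)).2.2.1) (fun k => ?_) fun l hl hbl hlt => ?_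
    · rw [Set.mem_Iic]
      rcases (Nat.lt_succ_iff.1 k.2).lt_or_eq with h | h
      · linarith [hmono k i h hi]
      · rw [h]
    · rw [Set.mem_Iic] at hlt
      obtain ⟨k, hk, rfl⟩ := hall i hi l hl hbl (by linarith)
      exact ⟨⟨k, Nat.lt_succ_iff.2 hk⟩, rfl⟩
  refine ⟨hl0, hb, hup, hlow, hthr, ⟨?_, rle.ge⟩, ?_⟩
  · rw [rlt]
    exact_mod_cast Nat.lt_succ_self i
  · have := rank_eigenSpan ha0 (b := b) (S := {4 * lam i}) (n := 1) (lam := fun _ => lam i)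
      (fun γ hγ => hγ ▸ hthr) (fun _ _ _ => Subsingleton.elim _ _) (fun _ => hb) (fun _ => rfl)
      (fun l _ _ hl => ⟨0, by
        rw [Set.mem_singleton_iff] at hl
        linarith⟩)
    simpa [IsSimpleEigenvalue] using this

/-- The absolute value makes the parameter nonnegative for every real `δ`, so that the family of
metrics is total; on the interval it is just `δ⁻¹`. -/
theorem contDiffOn_circFactor_inv_family {δ₀ : ℝ} :
    ContDiffOn ℝ ∞ (fun q : ℝ × ℂ => circFactor |q.1|⁻¹ q.2) (Set.Ioo 0 δ₀ ×ˢ closedDisc) ∧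
    ContDiffOn ℝ ∞ (fun q : ℝ × ℂ => |q.1|⁻¹) (Set.Ioo 0 δ₀ ×ˢ closedDisc) := by
  have hinv : ContDiffOn ℝ ∞ (fun q : ℝ × ℂ => |q.1|⁻¹) (Set.Ioo 0 δ₀ ×ˢ closedDisc) :=
    (ContDiffOn.inv (f := fun q : ℝ × ℂ => q.1) contDiff_fst.contDiffOn
      fun q hq => hq.1.1.ne').congr fun q hq => by simp [abs_of_pos hq.1.1]
  exact ⟨contDiffOn_circFactor_family.comp (hinv.prodMk contDiffOn_snd)
    fun q _ => ⟨Set.mem_Ici.2 (inv_nonneg.2 (abs_nonneg _)), Set.mem_univ _⟩, hinv⟩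

theorem nodal_of_isEigenfunction {a : ℝ} {M : ℕ} (ha : 2 * (M * Real.pi) < a) (ha0 : 0 ≤ a)
    (b : BoundaryCondition) {j : ℕ} (hj : 1 ≤ j) (hjM : j ≤ M) :
    ∃ γ : ℝ, IsNthEigenvalue (metric a ha0) b j γ ∧ IsSimpleEigenvalue (metric a ha0) b γ ∧
      ∀ u : ℂ → ℝ, IsEigenfunction (metric a ha0) b γ u → IsRadial u ∧
        (∃ ρ : Fin (j - 1) → ℝ, StrictMono ρ ∧ (∀ i, ρ i ∈ Set.Ioo (0 : ℝ) 1) ∧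
          nodalSet u = ⋃ i, Metric.sphere (0 : ℂ) (ρ i)) ∧ Nat.card (NodalDomains u) = j := by
  have hM : 0 < M := by omega
  have hK : 0 < M * Real.pi := by have := Real.pi_pos; positivity
  obtain ⟨lam, hlam⟩ := spectral_structure hM ha ha0 b
  obtain ⟨i, rfl⟩ : ∃ i, j = i + 1 := ⟨j - 1, by omega⟩
  obtain ⟨hl0, hb, hup, hlow, hthr, hnth, hsimple⟩ := hlam i (by omega)
  refine ⟨4 * lam i, hnth, hsimple, fun u hu => ?_⟩
  obtain ⟨-, -, k, hk, hku⟩ := eigenfunction_classification ha0 hu hthr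
  rw [mul_div_cancel_left₀ _ (four_ne_zero (α := ℝ))] at hku
  obtain ⟨τ, hτ, hτ01, hzero⟩ := exists_zeros_radialSol ha0 hK hl0 hlow hup
  exact ⟨isRadial_of_eq hku, nodal_structure hk hku hτ hτ01 hzero⟩

theorem exists_second_neumann_max_origin {a : ℝ} {M : ℕ} (hM : 2 ≤ M)
    (ha : 2 * (M * Real.pi) < a) (ha0 : 0 ≤ a) :
    ∃ γ : ℝ, IsNthEigenvalue (metric a ha0) BoundaryCondition.neumann 2 γ ∧
      ∃ u : ℂ → ℝ, IsEigenfunction (metric a ha0) BoundaryCondition.neumann γ u ∧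
        ∀ z ∈ closedDisc, z ≠ 0 → u z < u 0 := by
  have hπ := Real.pi_pos
  have hK : 0 < M * Real.pi := by positivity
  obtain ⟨lam, hlam⟩ := spectral_structure (by omega) ha ha0 .neumann
  obtain ⟨hl0, hb, hup, hlow, -, hnth, -⟩ := hlam 1 (by omega)
  refine ⟨4 * lam 1, hnth, radialFun a (lam 1), isEigenfunction_radialFun ha0 _ hb,
    fun z hz hz0 => ?_⟩
  have hlow0 := hlow 0 one_pos
  set l := lam 1
  have hl : 0 < l := by
    refine lt_of_le_of_ne hl0 fun h => ?_
    rw [← h] at hlow0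
    have := angle_param_zero_lt (a := a) hK
    push_cast at hlow0
    linarith
  -- The only multiple of `π` between `π / 2` and `3 π / 2`.
  have hone : angle a (M * Real.pi) l 1 = Real.pi := by
    obtain ⟨n, hn⟩ := Real.sin_eq_zero_iff.1
      (((radialBoundary_neumann_iff hK).1 hb).resolve_left hl.ne')
    rw [← hn] at hlow0 hup ⊢
    push_cast at hlow0 hup
    have hn1 : (0 : ℝ) < n := by
      by_contra! h
      nlinarith
    have hn2 : (n : ℝ) < 2 := by
      by_contra! h
      nlinarith
    have hn3 : 0 < n := by exact_mod_cast hn1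
    have hn4 : n < 2 := by exact_mod_cast hn2
    obtain rfl : n = 1 := by omega
    simp
  have hmono := strictMonoOn_angle ha0 hK hl0
  have hanti : StrictAntiOn (radialSol a l) (Set.Icc 0 1) := by
    refine strictAntiOn_of_deriv_neg (convex_Icc _ _)
      (continuous_radialSol_right a l).continuousOn fun t ht => ?_
    rw [interior_Icc] at ht
    have ht0 : 0 < t := ht.1
    rw [(hasDerivAt_radialSol_of_pos a l ht0.ne').deriv]
    have hs : 0 < primSol a l t := by
      have h1 : 0 < angle a (M * Real.pi) l t := by
        simpa [angle_zero] using hmono Set.self_mem_Ici ht0.le ht0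
      have h2 : angle a (M * Real.pi) l t < Real.pi :=
        (hmono ht0.le (Set.mem_Ici.2 zero_le_one) ht.2).trans_eq hone
      have h3 := (polar (a := a) hK l ht0.le).2
      have h4 := Real.sin_pos_of_pos_of_lt_pi h1 h2
      have h5 := Real.sqrt_pos.2 (radiusSq_pos a l hK ht0.le)
      have h6 : 0 < M * Real.pi * primSol a l t := by
        rw [h3]
        positivity
      exact pos_of_mul_pos_right h6 hK.le
    have : 0 < l * ((1 + a * t) / t) * primSol a l t := by positivity
    linarith
  have hz1 : ‖z‖ ≤ 1 := by simpa [closedDisc] using hz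
  have hpos : 0 < Complex.normSq z := Complex.normSq_pos.2 hz0
  have hle : Complex.normSq z ≤ 1 := by
    rw [Complex.normSq_eq_norm_sq]
    exact pow_le_one₀ (norm_nonneg z) hz1
  simp only [radialFun, map_zero]
  exact hanti ⟨le_rfl, zero_le_one⟩ ⟨hpos.le, hle⟩ hpos

end DiscSurface

/-! ### The family of metrics -/

open DiscSurface in
theorem mainTheorem2 (m : ℕ) (hm : 0 < m) :
    ∃ δ₀ : ℝ, 0 < δ₀ ∧ ∃ g : ℝ → RiemMetric,
      -- a smooth one-parameter family of pairwise distinct metrics, with `δ` in `(0, δ₀)`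
      ContDiffOn ℝ ∞ (fun q : ℝ × ℂ => (g q.1).E q.2) (Set.Ioo 0 δ₀ ×ˢ closedDisc) ∧
      ContDiffOn ℝ ∞ (fun q : ℝ × ℂ => (g q.1).F q.2) (Set.Ioo 0 δ₀ ×ˢ closedDisc) ∧
      ContDiffOn ℝ ∞ (fun q : ℝ × ℂ => (g q.1).G q.2) (Set.Ioo 0 δ₀ ×ˢ closedDisc) ∧
      (∀ δ ∈ Set.Ioo 0 δ₀, ∀ δ' ∈ Set.Ioo 0 δ₀, δ ≠ δ' →
        ∃ z ∈ closedDisc, (g δ).form z ≠ (g δ').form z) ∧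
      ∀ δ ∈ Set.Ioo 0 δ₀,
        (g δ).IsRotationInvariant ∧
        (∀ z ∈ closedDisc, 0 < (g δ).curvature z) ∧
        (g δ).area = Real.pi ∧
        -- for both boundary conditions the first `m` eigenvalues are simple, and every
        -- eigenfunction of the `j`-th one is radial with `j - 1` nodal circles
        (∀ b : BoundaryCondition, ∀ j : ℕ, 1 ≤ j → j ≤ m →
          ∃ γ : ℝ, IsNthEigenvalue (g δ) b j γ ∧ IsSimpleEigenvalue (g δ) b γ ∧
            ∀ u : ℂ → ℝ, IsEigenfunction (g δ) b γ u →
              IsRadial u ∧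
              (∃ ρ : Fin (j - 1) → ℝ, StrictMono ρ ∧ (∀ i, ρ i ∈ Set.Ioo (0 : ℝ) 1) ∧
                nodalSet u = ⋃ i, Metric.sphere (0 : ℂ) (ρ i)) ∧
              Nat.card (NodalDomains u) = j) ∧
        -- some second Neumann eigenfunction has its strict maximum at the origin
        (∃ γ : ℝ, IsNthEigenvalue (g δ) BoundaryCondition.neumann 2 γ ∧
          ∃ u : ℂ → ℝ, IsEigenfunction (g δ) BoundaryCondition.neumann γ u ∧
            ∀ z ∈ closedDisc, z ≠ 0 → u z < u 0) := by
  have hπ := Real.pi_pos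
  -- One eigenvalue more than requested, so that the second Neumann eigenvalue is controlled even
  -- for `m = 1`.
  set M := m + 1 with hM
  have hK : 0 < M * Real.pi := by positivity
  have hnn : ∀ δ : ℝ, 0 ≤ |δ|⁻¹ := fun δ => inv_nonneg.2 (abs_nonneg δ)
  obtain ⟨hv, ha⟩ := contDiffOn_circFactor_inv_family (δ₀ := (2 * (M * Real.pi))⁻¹)
  have hx : ContDiffOn ℝ ∞ (fun q : ℝ × ℂ => q.2.re)
      (Set.Ioo 0 (2 * (M * Real.pi))⁻¹ ×ˢ closedDisc) :=
    (contDiff_re.comp contDiff_snd).contDiffOn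
  have hy : ContDiffOn ℝ ∞ (fun q : ℝ × ℂ => q.2.im)
      (Set.Ioo 0 (2 * (M * Real.pi))⁻¹ ×ˢ closedDisc) :=
    (contDiff_im.comp contDiff_snd).contDiffOn
  have hv1 := (contDiffOn_const (c := (1 : ℝ))).add hv
  -- With `a = 1 / δ`, the bound on `δ` says precisely that `a > 2 M π`.
  refine ⟨(2 * (M * Real.pi))⁻¹, by positivity, fun δ => metric |δ|⁻¹ (hnn δ),
    hv.add ((ha.mul (hx.mul hx)).mul hv1), (ha.mul (hx.mul hy)).mul hv1,
    hv.add ((ha.mul (hy.mul hy)).mul hv1), ?_, ?_⟩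
  · intro δ hδ δ' hδ' hne
    -- At the boundary point `1` the squared length of the tangential vector `i` is `1 / (1 + a) = δ
    -- / (δ + 1)`, which determines `δ`.
    refine ⟨1, by simp, fun h => hne ?_⟩
    have h1 := congrFun (congrFun h Complex.I) Complex.I
    rw [metric_form, metric_form] at h1
    have e : ∀ c : ℝ, 0 < c → (1 + |c|⁻¹)⁻¹ = c / (c + 1) := fun c hc => by
      rw [abs_of_pos hc]
      field_simp
    simp [circFactor, e _ hδ.1, e _ hδ'.1] at h1
    have p1 := hδ.1
    have p2 := hδ'.1
    field_simp at h1
    linarith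
  intro δ hδ
  have habig : 2 * (M * Real.pi) < |δ|⁻¹ := by
    rw [abs_of_pos hδ.1, lt_inv_comm₀ (by positivity) hδ.1]
    exact hδ.2
  refine ⟨metric_isRotationInvariant (hnn δ), fun z hz => ?_, metric_area (hnn δ),
    fun b j hj hjm => nodal_of_isEigenfunction habig (hnn δ) b hj (by omega),
    exists_second_neumann_max_origin (by omega) habig (hnn δ)⟩
  simp only [metric_curvature (hnn δ) hz]
  have := circFactor_pos (hnn δ) z
  have : 0 < |δ|⁻¹ := by linarith
  positivity
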